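/- **Setting.** Let $T>0$, $x_0\in\mathbb R$, and let $\alpha,\beta:[0,T]\to\mathbb R$, $\zeta:[0,T]\to(0,\infty)$ be continuous. Let $X$ be the Gauss–Markov process $dX_t=(\alpha(t)+\beta(t)X_t)\,dt+\zeta(t)\,dB_t$, $X_0=x_0$, on $[0,T]$, where $B$ is a standard Brownian motion. Put $$\varphi(t,t')=e^{\int_t^{t'}\beta(u)\,du},\quad m_{t,x}(t')=\varphi(t,t')\Big(x+\int_t^{t'}\frac{\alpha(u)}{\varphi(t,u)}\,du\Big),\quad v_t^2(t')=\varphi(t,t')^2\int_t^{t'}\frac{\zeta(u)^2}{\varphi(t,u)^2}\,du,$$ $\varphi(t)=\varphi(0,t)$, $m(t)=m_{0,0}(t)$, $h(t)=\int_0^t\zeta(u)^2/\varphi(u)^2\,du$, $\mathsf T=h(T)$, and, for $s\in[0,1]$, $y\in\mathbb R$, $$a_0(s)=m(h^{-1}(s\mathsf T)),\qquad a_1(s)=\varphi(h^{-1}(s\mathsf T))\sqrt{\mathsf T},\qquad G(s,y)=a_0(s)+a_1(s)\,y,\qquad y_0=x_0/\sqrt{\mathsf T}.$$ Write $\phi(z;\theta,\gamma^2)$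 for the normal density with mean $\theta$ and variance $\gamma^2$. Let $\nu$ be a probability density on $\mathbb R$ and $\tilde\nu(z)=\nu\big((z-a_0(1))/a_1(1)\big)/a_1(1)$. *Randomized Brownian bridge.* For $s\in[0,1)$ and $y\in\mathbb R$ let $Z_{s,y}$ have the density proportional to $\frac{\phi(z;y,1-s)}{\phi(z;y_0,1)}\,\nu(z)$, and let $Z_{1,y}=y$. Let $P^\nu_{s,y}$ be the law of $(Y_{s+r})_{r\in[0,1-s]}$, where $Y$ is a Brownian motion started from $y$ at time $s$ and conditioned so that $Y_1\sim Z_{s,y}$; that is, the mixture, over the law of $Z_{s,y}$, of the conditional laws of the path given $Y_1=z$. *Randomized Gauss–Markov bridge.* Likewise, for $t\in[0,T)$ and $x\in\mathbb R$ let $\tilde Z_{t,x}$ have the density proportional to $\frac{\phi(z;m_{t,x}(T),v_t^2(T))}{\phi(z;m_{0,x_0}(T),v_0^2(T))}\,\tilde\nu(z)$, let $\tilde Z_{T,x}=x$, and let $P^\nu_{t,x}$ be the law of $(X_{t+u})_{u\in[0,T-t]}$ started from $x$ at time $t$ and conditioned so that $X_T\sim\tilde Z_{t,x}$. (Thus $P^\nu_{0,x_0}$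 is the law of $X$ conditioned to have terminal density $\tilde\nu$, and $P^\nu_{t,x}$ is that law given $X_t=x$.) Assume that for every $\varepsilon\in(0,1)$ there is $L_\varepsilon>0$ with $\operatorname{Var}[Z_{s,y}]\le L_\varepsilon$ for all $(s,y)\in(0,1-\varepsilon]\times\mathbb R$. Consider the optimal stopping problems $$V(t,x)=\sup_{\tau\le T-t}E^\nu_{t,x}[X_{t+\tau}],\qquad W(s,y)=\sup_{\sigma\le 1-s}E^\nu_{s,y}[G(s+\sigma,Y_{s+\sigma})],$$ over the stopping times of $(X_{t+u})_{u\in[0,T-t]}$ and of $(Y_{s+r})_{r\in[0,1-s]}$, respectively (natural filtrations, canonical path spaces). **Proposition (Equivalence of the optimal stopping problems).** For $(t,x)\in[0,T]\times\mathbb R$ take $s=h(t)/\mathsf T$ and $y=\dfrac{x-m(t)}{\varphi(t)\sqrt{\mathsf T}}$. Then $$V(t,x)=W(s,y).$$ Moreover, identify a path of $(X_{t+u})_u$ with a path of $(Y_{s+r})_r$ through $X_{t+u}=G(s+r,Y_{s+r})$ for $s+r=h(t+u)/\mathsf T$. Then $s+\sigma=h(t+\tau)/\mathsf T$ defines a one-to-one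 correspondence between the $[0,T-t]$-valued random times $\tau$ on the paths of $X$ and the $[0,1-s]$-valued random times $\sigma$ on the paths of $Y$, and if $s+\sigma^*=h(t+\tau^*)/\mathsf T$, then $\tau^*$ is an optimal stopping time for $V(t,x)$ if and only if $\sigma^*$ is an optimal stopping time for $W(s,y)$. -/

import Mathlib

open MeasureTheory ProbabilityTheory Filter Set
open scoped NNReal ENNReal Topology

namespace GaussMarkov

/-! ### Path space, its natural filtration, and optimal stopping -/

/-- Continuous paths on the time interval `[0, L]`. -/
abbrev PathSpace (L : ℝ) : Type := C(Set.Icc (0 : ℝ) L, ℝ)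

/-- The σ-algebra on path space generated by the coordinate process. -/
instance instMeasurableSpacePath (L : ℝ) : MeasurableSpace (PathSpace L) :=
  MeasurableSpace.comap (fun (ω : PathSpace L) (u : Set.Icc (0 : ℝ) L) => ω u) MeasurableSpace.pi

theorem measurable_coord {L : ℝ} (u : Set.Icc (0 : ℝ) L) :
    Measurable (fun ω : PathSpace L => ω u) :=
  (measurable_pi_apply u).comp (comap_measurable _)

theorem measurableSet_closedBall_path {L : ℝ} (f : PathSpace L) (r : ℝ) :
    MeasurableSet (Metric.closedBall f r) := by
  by_cases hr : 0 ≤ r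
  · obtain ⟨D, hDc, hDd⟩ := TopologicalSpace.exists_countable_dense (Set.Icc (0 : ℝ) L)
    have : Metric.closedBall f r = ⋂ u ∈ D, {g : PathSpace L | dist (g u) (f u) ≤ r} := by
      ext g
      simp only [Metric.mem_closedBall, Set.mem_iInter, Set.mem_ofPred_eq,
        ContinuousMap.dist_le hr]
      constructor
      · intro h u _
        exact h u
      · intro h u
        have hcl : IsClosed {u | dist (g u) (f u) ≤ r} :=
          isClosed_le (by fun_prop) continuous_const
        have := hcl.closure_subset_iff.2 (fun u hu => h u hu)
        exact this (hDd u)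
    rw [this]
    refine MeasurableSet.biInter hDc fun u _ => ?_
    exact measurableSet_le ((measurable_coord u).dist measurable_const) measurable_const
  · rw [Metric.closedBall_eq_empty.2 (not_le.1 hr)]
    exact MeasurableSet.empty

/-- This σ-algebra is the Borel σ-algebra of the uniform topology, so that path space is a standard
Borel space and regular conditional distributions on it exist. -/
instance instBorelSpacePath (L : ℝ) : BorelSpace (PathSpace L) := by
  constructor
  apply le_antisymm
  · have h : @Measurable (PathSpace L) _ (borel _) MeasurableSpace.pi
        (fun (ω : PathSpace L) (u : Set.Icc (0 : ℝ) L) => ω u) := by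
      refine @measurable_pi_lambda _ _ _ (borel _) _ _ fun u => ?_
      let _ : MeasurableSpace (PathSpace L) := borel _
      have : BorelSpace (PathSpace L) := ⟨rfl⟩
      exact (continuous_eval_const u).measurable
    exact h.comap_le
  · refine MeasurableSpace.generateFrom_le fun U hU => ?_
    have hU' : IsOpen U := hU
    choose! r hr0 hrU using fun x (hx : x ∈ U) => Metric.nhds_basis_closedBall.mem_iff.1
      (hU'.mem_nhds hx)
    obtain ⟨D, hDU, hDc, hD⟩ := TopologicalSpace.countable_cover_nhdsWithin
      (f := fun x => Metric.closedBall x (r x)) (s := U)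
      (fun x hx => mem_nhdsWithin_of_mem_nhds (Metric.closedBall_mem_nhds x (hr0 x hx)))
    have : U = ⋃ x ∈ D, Metric.closedBall x (r x) :=
      hD.antisymm (Set.iUnion₂_subset fun x hx => hrU x (hDU hx))
    rw [this]
    exact MeasurableSet.biUnion hDc fun x _ => measurableSet_closedBall_path x (r x)

/-- The value of a path at a real time (`0` outside `[0, L]`, where it is never used). -/
noncomputable def pathAt {L : ℝ} (ω : PathSpace L) (r : ℝ) : ℝ :=
  open Classical in if h : r ∈ Set.Icc (0 : ℝ) L then ω ⟨r, h⟩ else 0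

/-- The natural filtration of the coordinate process. -/
noncomputable def pathFiltration (L : ℝ) :
    Filtration (Set.Icc (0 : ℝ) L) (instMeasurableSpacePath L) :=
  Filtration.natural (fun u (ω : PathSpace L) => ω u)
    (fun u => (measurable_coord u).stronglyMeasurable)

/-- `τ`, with values in `[0, L]`, is a stopping time of the coordinate process. -/
def IsPathStoppingTime {L : ℝ} (τ : PathSpace L → Set.Icc (0 : ℝ) L) : Prop :=
  IsStoppingTime (pathFiltration L) (fun ω => ((τ ω : Set.Icc (0 : ℝ) L) : WithTop _))

/-- Expected gain `E[g(τ, ω_τ)]` when the coordinate process has law `P`. -/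
noncomputable def expectedGain {L : ℝ} (P : Measure (PathSpace L)) (g : ℝ → ℝ → ℝ)
    (τ : PathSpace L → Set.Icc (0 : ℝ) L) : ℝ :=
  ∫ ω, g (τ ω) (ω (τ ω)) ∂P

/-- The value of the optimal stopping problem: the supremum of the expected gains over all
stopping times of the coordinate process, in the extended reals. -/
noncomputable def stoppingValue {L : ℝ} (P : Measure (PathSpace L)) (g : ℝ → ℝ → ℝ) : EReal :=
  ⨆ (τ : PathSpace L → Set.Icc (0 : ℝ) L) (_ : IsPathStoppingTime τ), (expectedGain P g τ : EReal)

/-- `τ` is an optimal stopping time. -/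
def IsOptimalStoppingTime {L : ℝ} (P : Measure (PathSpace L)) (g : ℝ → ℝ → ℝ)
    (τ : PathSpace L → Set.Icc (0 : ℝ) L) : Prop :=
  IsPathStoppingTime τ ∧ (expectedGain P g τ : EReal) = stoppingValue P g

/-! ### Gauss–Markov processes -/

/-- The data of a Gauss–Markov process `dX = (α + β X) dt + ζ dB`, `X₀ = x₀`, on `[0, T]`. -/
structure Params where
  T : ℝ
  x₀ : ℝ
  α : ℝ → ℝ
  β : ℝ → ℝ
  ζ : ℝ → ℝ
  T_pos : 0 < T
  continuousOn_α : ContinuousOn α (Set.Icc 0 T)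
  continuousOn_β : ContinuousOn β (Set.Icc 0 T)
  continuousOn_ζ : ContinuousOn ζ (Set.Icc 0 T)
  ζ_pos : ∀ t ∈ Set.Icc 0 T, 0 < ζ t

/-- `I = ∫_a^b ζ dB` for a deterministic continuous integrand `ζ`: the limit in probability of the
left-point Riemann sums along the uniform partitions of `[a, b]`, where `0 ≤ a ≤ b`. -/
def IsWienerIntegral {Ω : Type*} [MeasurableSpace Ω] (μ : Measure Ω) (B : ℝ≥0 → Ω → ℝ)
    (ζ : ℝ → ℝ) (a b : ℝ) (I : Ω → ℝ) : Prop :=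
  TendstoInMeasure μ
    (fun (n : ℕ) (ω : Ω) => ∑ i ∈ Finset.range n,
      ζ (a + (i : ℝ) * ((b - a) / n)) *
        (B (a + ((i : ℝ) + 1) * ((b - a) / n)).toNNReal ω
          - B (a + (i : ℝ) * ((b - a) / n)).toNNReal ω))
    atTop I

namespace Params

variable (D : Params)

/-- `X` is `(X_{t+u})_{u ∈ [0, T - t]}` for the solution of the stochastic differential equation
driven by `B` that starts at time `t` from `x`. -/
structure IsSolution {Ω : Type*} [MeasurableSpace Ω] (μ : Measure Ω) (B : ℝ≥0 → Ω → ℝ)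
    (t x : ℝ) (X : Ω → PathSpace (D.T - t)) : Prop where
  aemeasurable : AEMeasurable X μ
  sde : ∀ u : Set.Icc (0 : ℝ) (D.T - t), IsWienerIntegral μ B D.ζ t (t + u)
    (fun ω => X ω u - x - ∫ r in (0 : ℝ)..u, (D.α (t + r) + D.β (t + r) * pathAt (X ω) r))

/-- `φ(t, t') = exp ∫_t^{t'} β`. -/
noncomputable def φ (t t' : ℝ) : ℝ := Real.exp (∫ u in t..t', D.β u)

/-- The conditional mean `m_{t,x}(t') = E[X_{t'} | X_t = x]`. -/
noncomputable def condMean (t x t' : ℝ) : ℝ := D.φ t t' * (x + ∫ u in t..t', D.α u / D.φ t u)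

/-- The conditional variance `v_t²(t') = Var[X_{t'} | X_t = x]`. -/
noncomputable def condVar (t t' : ℝ) : ℝ := D.φ t t' ^ 2 * ∫ u in t..t', D.ζ u ^ 2 / D.φ t u ^ 2

/-- The factors of the covariance `r₁(min(t, t')) r₂(max(t, t'))`. -/
noncomputable def r₁ (t : ℝ) : ℝ := D.φ 0 t * ∫ u in (0 : ℝ)..t, D.ζ u ^ 2 / D.φ 0 u ^ 2

noncomputable def r₂ (t : ℝ) : ℝ := D.φ 0 t

/-- The time change `h = r₁ / r₂`. -/
noncomputable def h (t : ℝ) : ℝ := D.r₁ t / D.r₂ t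

/-- `m = m_{0,0}`. -/
noncomputable def m (t : ℝ) : ℝ := D.condMean 0 0 t

/-- `𝖳 = h(T)`. -/
noncomputable def hT : ℝ := D.h D.T

/-- The inverse of `h : [0, T] → [0, 𝖳]`. -/
noncomputable def hInv : ℝ → ℝ := Function.invFunOn D.h (Set.Icc 0 D.T)

noncomputable def a₀ (s : ℝ) : ℝ := D.m (D.hInv (s * D.hT))

noncomputable def a₁ (s : ℝ) : ℝ := D.φ 0 (D.hInv (s * D.hT)) * √D.hT

/-- The gain function. -/
noncomputable def G (s y : ℝ) : ℝ := D.a₀ s + D.a₁ s * y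

/-- The starting point of the standardized process: `x₀ = G(0, y₀)`. -/
noncomputable def y₀ : ℝ := D.x₀ / √D.hT

/-- The terminal density of `G(1, Z)` when `Z` has density `ν`. -/
noncomputable def terminalDensity (ν : ℝ → ℝ) (z : ℝ) : ℝ :=
  ν ((z - D.a₀ 1) / D.a₁ 1) / D.a₁ 1

end Params

/-! ### Conditioning on a terminal density -/

/-- The density `φ(z; θ, γ²)` of the normal distribution with mean `θ` and variance `γ²`. -/
noncomputable def normalDensity (θ γsq z : ℝ) : ℝ := gaussianPDFReal θ γsq.toNNReal z

/-- The probability law with density proportional to `w`. -/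
noncomputable def lawProportionalTo (w : ℝ → ℝ) : Measure ℝ :=
  (∫⁻ z, ENNReal.ofReal (w z))⁻¹ • volume.withDensity (fun z => ENNReal.ofReal (w z))

/-- The law of a process on `[0, L]` with unconditioned law `R`, conditioned to have terminal law
`π`: the mixture `∫ R(· | ω_L = z) π(dz)` of the regular conditional laws given the terminal
value. -/
noncomputable def conditionedLaw {L : ℝ} (R : Measure (PathSpace L)) [IsFiniteMeasure R]
    (π : Measure ℝ) : Measure (PathSpace L) :=
  π.bind (condDistrib (fun ω : PathSpace L => ω) (fun ω => pathAt ω L) R)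

/-- The law of the pinning point `Z_{s,y}` of the randomized Brownian bridge that starts at time
`0` from `y₀` and has terminal density `ν`, given that it is at `y` at time `s`. -/
noncomputable def bbPinningLaw (ν : ℝ → ℝ) (y₀ s y : ℝ) : Measure ℝ :=
  open Classical in
  if s < 1 then
    lawProportionalTo (fun z => normalDensity y (1 - s) z / normalDensity y₀ 1 z * ν z)
  else Measure.dirac y

/-- The law of the terminal value of the randomized Gauss–Markov bridge `X` (that starts at time
`0` from `x₀` and whose terminal value has the density of `G(1, Z)`, `Z ∼ ν`), given `X_t = x`:
the prior terminal density times the ratio of the transition densities of the unconditioned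
process from `(t, x)` and from `(0, x₀)` to time `T`, normalized. -/
noncomputable def gmPinningLaw (D : Params) (ν : ℝ → ℝ) (t x : ℝ) : Measure ℝ :=
  open Classical in
  if t < D.T then
    lawProportionalTo (fun z =>
      normalDensity (D.condMean t x D.T) (D.condVar t D.T) z /
        normalDensity (D.condMean 0 D.x₀ D.T) (D.condVar 0 D.T) z * D.terminalDensity ν z)
  else Measure.dirac x

/-- `ν` is a probability density. -/
structure IsDensity (ν : ℝ → ℝ) : Prop where
  measurable : Measurable ν
  nonneg : ∀ z, 0 ≤ ν z
  lintegral_eq_one : ∫⁻ z, ENNReal.ofReal (ν z) = 1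

/-- For every `ε ∈ (0, 1)`, the variance of the pinning point `Z_{s,y}` is bounded uniformly over
`(s, y) ∈ (0, 1 - ε] × ℝ`. -/
def RegularTerminalDensity (ν : ℝ → ℝ) (y₀ : ℝ) : Prop :=
  ∀ ε ∈ Set.Ioo (0 : ℝ) 1, ∃ C > 0, ∀ s ∈ Set.Ioc 0 (1 - ε), ∀ y : ℝ,
    evariance id (bbPinningLaw ν y₀ s y) ≤ ENNReal.ofReal C

/-- `P_{t,x}^ν`: the law of the randomized Gauss–Markov bridge `(X_{t+u})_{u ∈ [0, T-t]}` given
`X_t = x`, where `X` (on a probability space with measure `μ`) is the unconditioned process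
started at time `t` from `x`. -/
noncomputable def gmBridgeLaw (D : Params) (ν : ℝ → ℝ) (t x : ℝ) {Ω : Type*} [MeasurableSpace Ω]
    (μ : Measure Ω) [IsProbabilityMeasure μ] (X : Ω → PathSpace (D.T - t)) :
    Measure (PathSpace (D.T - t)) :=
  conditionedLaw (μ.map X) (gmPinningLaw D ν t x)

/-- `P_{s,y}^ν`: the law of the randomized Brownian bridge `(Y_{s+r})_{r ∈ [0, 1-s]}` given
`Y_s = y`, where `Y` (on a probability space with measure `μ`) is the Brownian motion started at
time `s` from `y`. -/
noncomputable def bbBridgeLaw (ν : ℝ → ℝ) (y₀ s y : ℝ) {Ω : Type*} [MeasurableSpace Ω]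
    (μ : Measure Ω) [IsProbabilityMeasure μ] (Y : Ω → PathSpace (1 - s)) :
    Measure (PathSpace (1 - s)) :=
  conditionedLaw (μ.map Y) (bbPinningLaw ν y₀ s y)

/-- `(Y_{s+r})_{r ∈ [0, 1-s]}` is the Brownian motion started at time `s` from `y`, driven by the
increments of the standard Brownian motion `B`. -/
structure IsBrownianFrom {Ω : Type*} [MeasurableSpace Ω] (μ : Measure Ω) (B : ℝ≥0 → Ω → ℝ)
    (s y : ℝ) (Y : Ω → PathSpace (1 - s)) : Prop where
  aemeasurable : AEMeasurable Y μ
  eq_add : ∀ᵐ ω ∂μ, ∀ r : Set.Icc (0 : ℝ) (1 - s),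
    Y ω r = y + (B (s + r).toNNReal ω - B s.toNNReal ω)

/-! ### The two problems and the time change -/

/-- The gain of the original problem: the value of the process. -/
def identityGain (_u x : ℝ) : ℝ := x

/-- The gain of the transformed problem started at time `s`, as a function of elapsed time. -/
noncomputable def bridgeGain (D : Params) (s r y : ℝ) : ℝ := D.G (s + r) y

/-- The paths `ω` of `(X_{t+u})_u` and `η` of `(Y_{s+r})_r` correspond to each other:
`X_{t+u} = G(s + r, Y_{s+r})` whenever `s + r = h(t + u) / 𝖳`. -/
def PathsCorrespond (D : Params) (t s : ℝ) (ω : PathSpace (D.T - t)) (η : PathSpace (1 - s)) :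
    Prop :=
  ∀ (u : Set.Icc (0 : ℝ) (D.T - t)) (r : Set.Icc (0 : ℝ) (1 - s)),
    s + (r : ℝ) = D.h (t + u) / D.hT → ω u = D.G (s + r) (η r)

/-- The random times `τ` and `σ` satisfy `s + σ = h(t + τ) / 𝖳`, pathwise. -/
def TimesCorrespond (D : Params) (t s : ℝ) (τ : PathSpace (D.T - t) → Set.Icc (0 : ℝ) (D.T - t))
    (σ : PathSpace (1 - s) → Set.Icc (0 : ℝ) (1 - s)) : Prop :=
  ∀ ω η, PathsCorrespond D t s ω η → s + (σ η : ℝ) = D.h (t + τ ω) / D.hT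

end GaussMarkov

open GaussMarkov

/-!
The process `X` is a standardized Brownian motion run along the clock `h`: with `c` the time change
`u ↦ h(t + u) / h(T) - s`, the map `ω ↦ η`, `ω(u) = m(t + u) + φ(0, t + u) √h(T) η(c(u))`, is a
bijection `pathEquiv` between the two path spaces, measurable in both directions. It carries the
law of the randomized Gauss–Markov bridge to that of the randomized Brownian bridge
(`map_pathEquiv_gmBridgeLaw`). As the gain function `G` undoes the map coordinate by coordinate and
`c` is increasing, corresponding random times have equal gains and are stopping times
simultaneously, so the two optimal stopping problems are the same problem in two coordinate systems.

The equality of the laws has three ingredients.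

* The unconditioned processes correspond (`map_pathEquiv_solution`). The equation determines `X`
  through Wiener integrals. These are handled as pairs `(F, f)` of a random variable and a function
  with `E exp(iF) = exp(-∫ f² / 2)`, which form vector spaces stable under limits
  (`IsIsonormal.limitClosure`). The noise `∫ ζ dB` is such a limit of Riemann sums, and variation of
  constants exhibits the discounted process `X / φ`, without its drift, as a limit of Riemann sums
  of `∫ φ⁻¹ d(noise)`, that corresponds to the function `ζ / φ` (`discounted_mem`). Inner products
  of functions determine the finite-dimensional laws (`IsIsonormal.map_eq_map`), and after the time
  change they are those of Brownian motion, since `h' = ζ² / φ²`.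
* The pinning laws correspond under the affine map of the terminal values, because normal densities
  and `ν` scale together (`map_standardize_gmPinningLaw`).
* Conditioning on the terminal value commutes with the bijection (`map_conditionedLaw`). Regular
  conditional laws are unique only up to null sets, which is harmless as the pinning law is
  dominated by the unconditioned terminal law (`bbPinningLaw_absolutelyContinuous`).
-/

namespace GaussMarkov

/-! ### Isonormal families and Wiener integrals -/

section Isonormal

variable {Ω : Type*} [MeasurableSpace Ω] {μ : Measure Ω}

/-- A vector space of pairs `(F, f)` of a random variable and a square integrable function in which
`F` is centred Gaussian with variance `∫ f²`. Such pairs behave like `F = ∫ f dB`. It is enough to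
specify the characteristic function at `1`, since the space contains all the multiples of `(F, f)`. -/
def IsIsonormal (μ : Measure Ω) (R : Submodule ℝ ((Ω → ℝ) × (ℝ → ℝ))) : Prop :=
  ∀ p ∈ R, AEMeasurable p.1 μ ∧ MemLp p.2 2 volume ∧
    ∫ ω, Complex.exp (p.1 ω * Complex.I) ∂μ = Complex.exp (-(∫ x, p.2 x ^ 2 : ℝ) / 2)

/-- The pairs that are limits of sequences of pairs in `R`: almost surely for the random variables,
and pointwise and dominated in `L²` for the functions. -/
def limitClosure (μ : Measure Ω) (R : Submodule ℝ ((Ω → ℝ) × (ℝ → ℝ))) :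
    Submodule ℝ ((Ω → ℝ) × (ℝ → ℝ)) where
  carrier := {p | ∃ q : ℕ → (Ω → ℝ) × (ℝ → ℝ), (∀ n, q n ∈ R) ∧
    (∀ᵐ ω ∂μ, Tendsto (fun n => (q n).1 ω) atTop (𝓝 (p.1 ω))) ∧
    (∀ x, Tendsto (fun n => (q n).2 x) atTop (𝓝 (p.2 x))) ∧
    ∃ g, MemLp g 2 volume ∧ ∀ n x, |(q n).2 x| ≤ g x}
  add_mem' := by
    rintro p p' ⟨q, hq, h1, h2, g, hg, hb⟩ ⟨q', hq', h1', h2', g', hg', hb'⟩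
    refine ⟨q + q', fun n => R.add_mem (hq n) (hq' n), ?_, fun x => (h2 x).add (h2' x),
      g + g', hg.add hg', fun n x => (abs_add_le _ _).trans (add_le_add (hb n x) (hb' n x))⟩
    filter_upwards [h1, h1'] with ω hω hω' using hω.add hω'
  zero_mem' := ⟨0, fun _ => R.zero_mem, by simp, by simp, 0, MemLp.zero, by simp⟩
  smul_mem' := by
    rintro c p ⟨q, hq, h1, h2, g, hg, hb⟩
    refine ⟨c • q, fun n => R.smul_mem c (hq n), ?_, fun x => (h2 x).const_mul c,
      |c| • g, hg.const_smul _, fun n x => ?_⟩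
    · filter_upwards [h1] with ω hω using hω.const_mul c
    · simpa [abs_mul] using mul_le_mul_of_nonneg_left (hb n x) (abs_nonneg c)

theorem IsIsonormal.limitClosure [IsProbabilityMeasure μ]
    {R : Submodule ℝ ((Ω → ℝ) × (ℝ → ℝ))} (hR : IsIsonormal μ R) :
    IsIsonormal μ (limitClosure μ R) := by
  rintro p ⟨q, hq, h1, h2, g, hg, hb⟩
  have hm1 : AEMeasurable p.1 μ :=
    aemeasurable_of_tendsto_metrizable_ae atTop (fun n => (hR _ (hq n)).1) h1
  have hm2 : AEStronglyMeasurable p.2 volume :=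
    aestronglyMeasurable_of_tendsto_ae atTop (fun n => (hR _ (hq n)).2.1.1) (ae_of_all _ h2)
  have hpb (x : ℝ) : |p.2 x| ≤ g x := le_of_tendsto (h2 x).abs (Eventually.of_forall (hb · x))
  refine ⟨hm1, hg.mono hm2 (ae_of_all _ fun x => (hpb x).trans (le_abs_self _)), ?_⟩
  have hL : Tendsto (fun n => ∫ ω, Complex.exp ((q n).1 ω * Complex.I) ∂μ) atTop
      (𝓝 (∫ ω, Complex.exp (p.1 ω * Complex.I) ∂μ)) := by
    refine tendsto_integral_of_dominated_convergence (fun _ => 1) (fun n => ?_)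
      (integrable_const _) (fun n => ae_of_all _ fun ω => ?_) ?_
    · have := (hR _ (hq n)).1
      exact AEMeasurable.aestronglyMeasurable (by fun_prop)
    · rw [Complex.norm_exp_ofReal_mul_I]
    · filter_upwards [h1] with ω hω
      exact (Complex.continuous_exp.tendsto _).comp
        (((Complex.continuous_ofReal.tendsto _).comp hω).mul_const _)
  have hV : Tendsto (fun n => ∫ x, (q n).2 x ^ 2) atTop (𝓝 (∫ x, p.2 x ^ 2)) := by
    refine tendsto_integral_of_dominated_convergence (fun x => g x ^ 2)
      (fun n => (hR _ (hq n)).2.1.1.pow 2) hg.integrable_sq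
      (fun n => ae_of_all _ fun x => ?_) (ae_of_all _ fun x => (h2 x).pow 2)
    rw [Real.norm_eq_abs, abs_pow]
    exact pow_le_pow_left₀ (abs_nonneg _) (hb n x) 2
  refine tendsto_nhds_unique hL ?_
  simp_rw [(hR _ (hq _)).2.2]
  exact (Complex.continuous_exp.tendsto _).comp
    (((Complex.continuous_ofReal.tendsto _).comp hV).neg.div_const _)

/-- The joint characteristic function, obtained by polarization of the defining property. -/
theorem IsIsonormal.integral_exp_sum {R : Submodule ℝ ((Ω → ℝ) × (ℝ → ℝ))}
    (hR : IsIsonormal μ R) {ι : Type*} [Fintype ι] {p : ι → (Ω → ℝ) × (ℝ → ℝ)}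
    (hp : ∀ i, p i ∈ R) (c : ι → ℝ) :
    ∫ ω, Complex.exp ((∑ i, (p i).1 ω * c i : ℝ) * Complex.I) ∂μ =
      Complex.exp (-(∑ i, ∑ j, c i * c j * ∫ x, (p i).2 x * (p j).2 x : ℝ) / 2) := by
  have h := (hR (∑ i, c i • p i) (R.sum_mem fun i _ => R.smul_mem _ (hp i))).2.2
  have e1 (ω : Ω) : (∑ i, c i • p i).1 ω = ∑ i, (p i).1 ω * c i := by
    simp [Prod.fst_sum, mul_comm]
  have e2 (x : ℝ) : (∑ i, c i • p i).2 x ^ 2 =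
      ∑ i, ∑ j, c i * c j * ((p i).2 x * (p j).2 x) := by
    simp only [Prod.snd_sum, Finset.sum_apply, Prod.smul_snd, Pi.smul_apply, smul_eq_mul, sq,
      Finset.sum_mul_sum]
    exact Finset.sum_congr rfl fun i _ => Finset.sum_congr rfl fun j _ => by ring
  simp_rw [e1, e2] at h
  rw [h, integral_finsetSum]
  · congr 4
    refine Finset.sum_congr rfl fun i _ => ?_
    rw [integral_finsetSum]
    · simp_rw [integral_const_mul]
    · exact fun j _ => ((hR _ (hp i)).2.1.integrable_mul (hR _ (hp j)).2.1).const_mul _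
  · exact fun i _ => integrable_finsetSum _ fun j _ =>
      ((hR _ (hp i)).2.1.integrable_mul (hR _ (hp j)).2.1).const_mul _

/-- The joint law of a finite family in an isonormal family is determined by the inner products of
the corresponding functions. -/
theorem IsIsonormal.map_eq_map {Ω' : Type*} [MeasurableSpace Ω'] {μ' : Measure Ω'}
    [IsProbabilityMeasure μ] [IsProbabilityMeasure μ']
    {R : Submodule ℝ ((Ω → ℝ) × (ℝ → ℝ))} {R' : Submodule ℝ ((Ω' → ℝ) × (ℝ → ℝ))}
    (hR : IsIsonormal μ R) (hR' : IsIsonormal μ' R') {ι : Type*} [Fintype ι]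
    {p : ι → (Ω → ℝ) × (ℝ → ℝ)} {p' : ι → (Ω' → ℝ) × (ℝ → ℝ)}
    (hp : ∀ i, p i ∈ R) (hp' : ∀ i, p' i ∈ R')
    (hinner : ∀ i j, ∫ x, (p i).2 x * (p j).2 x = ∫ x, (p' i).2 x * (p' j).2 x) :
    μ.map (fun ω i => (p i).1 ω) = μ'.map (fun ω i => (p' i).1 ω) := by
  classical
  have hm : AEMeasurable (fun ω i => (p i).1 ω) μ :=
    aemeasurable_pi_lambda _ fun i => (hR _ (hp i)).1
  have hm' : AEMeasurable (fun ω i => (p' i).1 ω) μ' :=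
    aemeasurable_pi_lambda _ fun i => (hR' _ (hp' i)).1
  have := Measure.isProbabilityMeasure_map hm
  have := Measure.isProbabilityMeasure_map hm'
  refine Measure.ext_of_charFunDual (funext fun l => ?_)
  have hl (v : ι → ℝ) : l v = ∑ i, v i * l (fun j => if i = j then 1 else 0) :=
    LinearMap.pi_apply_eq_sum_univ l.toLinearMap v
  rw [charFunDual_apply, charFunDual_apply, integral_map hm (by fun_prop),
    integral_map hm' (by fun_prop)]
  simp_rw [hl (fun i => (p _).1 _), hl (fun i => (p' _).1 _)]
  rw [hR.integral_exp_sum hp, hR'.integral_exp_sum hp']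
  simp_rw [hinner]

/-- The span of the pairs `(B_b, 1_{(0, b]})` for a process `B`. -/
noncomputable def brownianFamily (B : ℝ≥0 → Ω → ℝ) : Submodule ℝ ((Ω → ℝ) × (ℝ → ℝ)) :=
  Submodule.span ℝ (Set.range fun b : ℝ≥0 => (B b, (Ioc (0 : ℝ) b).indicator fun _ => (1 : ℝ)))

theorem memLp_indicator_Ioc (a b : ℝ) :
    MemLp ((Ioc a b).indicator fun _ => (1 : ℝ)) 2 volume :=
  memLp_indicator_const _ measurableSet_Ioc _ (Or.inr (by simp))

theorem isIsonormal_brownianFamily [IsProbabilityMeasure μ] {B : ℝ≥0 → Ω → ℝ}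
    (hB : IsPreBrownianReal B μ) : IsIsonormal μ (brownianFamily B) := by
  intro p hp
  obtain ⟨c, rfl⟩ := Finsupp.mem_span_range_iff_exists_finsupp.1 hp
  have e1 : (c.sum fun b r => r • (B b, (Ioc (0 : ℝ) b).indicator fun _ => (1 : ℝ))).1 =
      fun ω => ∑ b ∈ c.support, c b • B b ω := by
    ext ω; simp [Finsupp.sum, Prod.fst_sum]
  have e2 : (c.sum fun b r => r • (B b, (Ioc (0 : ℝ) b).indicator fun _ => (1 : ℝ))).2 =
      fun x => ∑ b ∈ c.support, c b * (Ioc (0 : ℝ) b).indicator (fun _ => (1 : ℝ)) x := by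
    ext x; simp [Finsupp.sum, Prod.snd_sum]
  have hG : HasGaussianLaw (fun ω => ∑ b ∈ c.support, c b • B b ω) μ :=
    (hB.isGaussianProcess.smul c).hasGaussianLaw_fun_sum
  have hL2 (b : ℝ≥0) : MemLp (fun ω => c b • B b ω) 2 μ :=
    ((hB.isGaussianProcess.smul c).hasGaussianLaw_eval b).memLp_two
  have hmean : ∫ ω, ∑ b ∈ c.support, c b • B b ω ∂μ = 0 := by
    rw [integral_finsetSum _ fun b _ => (hL2 b).integrable (by simp)]
    simp_rw [smul_eq_mul, integral_const_mul, hB.integral_eval]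
    simp
  have hInt (b d : ℝ≥0) : Integrable (fun x => (Ioc (0 : ℝ) b).indicator (fun _ => (1 : ℝ)) x *
      (Ioc (0 : ℝ) d).indicator (fun _ => (1 : ℝ)) x) :=
    (memLp_indicator_Ioc _ _).integrable_mul (memLp_indicator_Ioc _ _)
  have hcov (b d : ℝ≥0) : ∫ x, (Ioc (0 : ℝ) b).indicator (fun _ => (1 : ℝ)) x *
      (Ioc (0 : ℝ) d).indicator (fun _ => (1 : ℝ)) x = min b d := by
    simp_rw [← Set.inter_indicator_mul, Ioc_inter_Ioc]
    rw [mul_one, integral_indicator measurableSet_Ioc]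
    simp
  have hvar : Var[fun ω => ∑ b ∈ c.support, c b • B b ω; μ] = ∫ x,
      (∑ b ∈ c.support, c b * (Ioc (0 : ℝ) b).indicator (fun _ => (1 : ℝ)) x) ^ 2 := by
    rw [variance_fun_sum' fun b _ => hL2 b]
    simp_rw [sq, Finset.sum_mul_sum, mul_mul_mul_comm, smul_eq_mul]
    rw [integral_finsetSum _ fun b _ => integrable_finsetSum _ fun d _ => (hInt b d).const_mul _]
    refine Finset.sum_congr rfl fun b _ => ?_
    rw [integral_finsetSum _ fun d _ => (hInt b d).const_mul _]
    refine Finset.sum_congr rfl fun d _ => ?_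
    rw [integral_const_mul, hcov, covariance_const_mul_left, covariance_const_mul_right,
      hB.covariance_fun_eval]
    ring
  rw [e1, e2]
  refine ⟨hG.aemeasurable, memLp_finsetSum _ fun b _ => (memLp_indicator_Ioc 0 b).const_mul _, ?_⟩
  have := congrFun (congrArg charFun hG.map_eq_gaussianReal) 1
  rw [charFun_gaussianReal, charFun_apply_real, integral_map hG.aemeasurable (by fun_prop), hmean,
    hvar, Real.coe_toNNReal _ (integral_nonneg fun x => sq_nonneg _)] at this
  simpa [neg_div] using this

end Isonormal

theorem sub_mem_brownianFamily {Ω : Type*} (B : ℝ≥0 → Ω → ℝ) {a b : ℝ} (ha : 0 ≤ a) (hab : a ≤ b) :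
    (B b.toNNReal - B a.toNNReal, (Ioc a b).indicator fun _ => (1 : ℝ)) ∈ brownianFamily B := by
  have hmem (c : ℝ) (hc : 0 ≤ c) :
      (B c.toNNReal, (Ioc (0 : ℝ) c).indicator fun _ => (1 : ℝ)) ∈ brownianFamily B :=
    Submodule.subset_span ⟨c.toNNReal, by simp [hc]⟩
  convert (brownianFamily B).sub_mem (hmem b (ha.trans hab)) (hmem a ha) using 1
  refine Prod.ext rfl (funext fun x => ?_)
  simp only [Prod.snd_sub, Pi.sub_apply, Set.indicator, mem_Ioc]
  split_ifs <;> grind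

/-- The `i`-th point of the uniform partition of `[a, b]` into `n` intervals. -/
noncomputable def partitionPoint (a b : ℝ) (n i : ℕ) : ℝ := a + (i : ℝ) * ((b - a) / n)

theorem partitionPoint_zero (a b : ℝ) (n : ℕ) : partitionPoint a b n 0 = a := by
  simp [partitionPoint]

theorem partitionPoint_self (a b : ℝ) {n : ℕ} (hn : n ≠ 0) : partitionPoint a b n n = b := by
  have : (n : ℝ) ≠ 0 := by exact_mod_cast hn
  simp only [partitionPoint]
  field_simp
  ring

theorem partitionPoint_succ (a b : ℝ) (n i : ℕ) :
    partitionPoint a b n (i + 1) = partitionPoint a b n i + (b - a) / n := by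
  simp only [partitionPoint]
  push_cast
  ring

theorem monotone_partitionPoint {a b : ℝ} (hab : a ≤ b) (n : ℕ) :
    Monotone (partitionPoint a b n) :=
  monotone_nat_of_le_succ fun i => by
    rw [partitionPoint_succ]
    have : 0 ≤ (b - a) / n := div_nonneg (by linarith) (by positivity)
    linarith

theorem partitionPoint_mem {a b : ℝ} (hab : a ≤ b) {n i : ℕ} (hi : i ≤ n) :
    partitionPoint a b n i ∈ Icc a b := by
  rcases Nat.eq_zero_or_pos n with rfl | hn
  · simpa [partitionPoint] using hab
  · refine ⟨?_, ?_⟩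
    · exact (partitionPoint_zero a b n).symm.trans_le
        (monotone_partitionPoint hab n (Nat.zero_le i))
    · exact (monotone_partitionPoint hab n hi).trans_eq (partitionPoint_self a b hn.ne')

/-- A step function takes at every point the value of the step that contains it. -/
theorem exists_sum_indicator_eq {u : ℕ → ℝ} (hu : Monotone u) (c : ℕ → ℝ) (k : ℝ → ℝ) {x : ℝ}
    (n : ℕ) (hx : x ∈ Ioc (u 0) (u n)) :
    ∃ i < n, x ∈ Ioc (u i) (u (i + 1)) ∧
      ∑ j ∈ Finset.range n, c j * (Ioc (u j) (u (j + 1))).indicator k x = c i * k x := by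
  induction n with
  | zero => exact absurd hx (by simp)
  | succ n ih =>
    rw [Finset.sum_range_succ]
    rcases le_or_gt x (u n) with h | h
    · obtain ⟨i, hi, hxi, hs⟩ := ih ⟨hx.1, h⟩
      refine ⟨i, hi.trans (Nat.lt_succ_self n), hxi, ?_⟩
      rw [hs, indicator_of_notMem (fun h' => absurd h'.1 (not_lt.2 h)), mul_zero, add_zero]
    · have hxn : x ∈ Ioc (u n) (u (n + 1)) := ⟨h, hx.2⟩
      refine ⟨n, Nat.lt_succ_self n, hxn, ?_⟩
      rw [Finset.sum_eq_zero, zero_add, indicator_of_mem hxn]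
      intro j hj
      have hj' : x ∉ Ioc (u j) (u (j + 1)) := fun h' =>
        absurd (h'.2.trans (hu (Finset.mem_range.1 hj))) (not_le.2 h)
      rw [indicator_of_notMem hj', mul_zero]

section RiemannSum

variable {Ω : Type*} [MeasurableSpace Ω] {μ : Measure Ω}

/-- Left-point Riemann sums of `∫ g dM` along the uniform partitions of `[a, b]`, taken in an
isonormal family where the increments of `M` correspond to the restrictions of `k`, converge to a
random variable that corresponds to `g k` on `(a, b]`. -/
theorem mem_limitClosure_of_riemannSum {R : Submodule ℝ ((Ω → ℝ) × (ℝ → ℝ))} {M : ℝ → Ω → ℝ}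
    {g k : ℝ → ℝ} {a b : ℝ} (hab : a ≤ b)
    (hM : ∀ u v, a ≤ u → u ≤ v → v ≤ b → (M v - M u, (Ioc u v).indicator k) ∈ R)
    (hg : ContinuousOn g (Icc a b)) {C : ℝ} (hk : ∀ x ∈ Icc a b, |k x| ≤ C) {I : Ω → ℝ}
    (hI : TendstoInMeasure μ (fun (n : ℕ) ω => ∑ i ∈ Finset.range n,
      g (partitionPoint a b n i) *
        (M (partitionPoint a b n (i + 1)) ω - M (partitionPoint a b n i) ω)) atTop I) :
    (I, (Ioc a b).indicator fun x => g x * k x) ∈ limitClosure μ R := by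
  -- Convergence in measure gives the almost sure limit of `limitClosure` along a subsequence.
  obtain ⟨ns, hns, hae⟩ := hI.exists_seq_tendsto_ae
  set q : ℕ → (Ω → ℝ) × (ℝ → ℝ) := fun n => ∑ i ∈ Finset.range n,
    g (partitionPoint a b n i) • (M (partitionPoint a b n (i + 1)) - M (partitionPoint a b n i),
      (Ioc (partitionPoint a b n i) (partitionPoint a b n (i + 1))).indicator k) with hq
  have hq1 (n : ℕ) (ω : Ω) : (q n).1 ω = ∑ i ∈ Finset.range n, g (partitionPoint a b n i) *
      (M (partitionPoint a b n (i + 1)) ω - M (partitionPoint a b n i) ω) := by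
    simp [hq, Prod.fst_sum]
  have hq2 (n : ℕ) (x : ℝ) : (q n).2 x = ∑ i ∈ Finset.range n, g (partitionPoint a b n i) *
      (Ioc (partitionPoint a b n i) (partitionPoint a b n (i + 1))).indicator k x := by
    simp [hq, Prod.snd_sum]
  -- On `(a, b]` the step function is `g k` with `g` evaluated within one mesh width.
  have hin {n : ℕ} (hn : n ≠ 0) {x : ℝ} (hx : x ∈ Ioc a b) :
      ∃ y ∈ Icc a b, |y - x| ≤ (b - a) / n ∧ (q n).2 x = g y * k x := by
    obtain ⟨i, hi, hxi, hs⟩ := exists_sum_indicator_eq (monotone_partitionPoint hab n)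
      (fun i => g (partitionPoint a b n i)) k n (x := x)
      (by rwa [partitionPoint_zero, partitionPoint_self a b hn])
    refine ⟨_, partitionPoint_mem hab hi.le, ?_, (hq2 n x).trans hs⟩
    rw [partitionPoint_succ] at hxi
    rw [abs_le]
    constructor <;> linarith [hxi.1, hxi.2]
  have hout (n : ℕ) {x : ℝ} (hx : x ∉ Ioc a b) : (q n).2 x = 0 := by
    rw [hq2]
    refine Finset.sum_eq_zero fun i hi => ?_
    rw [indicator_of_notMem, mul_zero]
    intro h
    have hi' := Finset.mem_range.1 hi
    exact hx ⟨(partitionPoint_mem hab hi'.le).1.trans_lt h.1,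
      h.2.trans (partitionPoint_mem hab hi').2⟩
  obtain ⟨K, hK⟩ := isCompact_Icc.exists_bound_of_continuousOn hg
  refine ⟨fun j => q (ns j), fun j => R.sum_mem fun i hi => R.smul_mem _ ?_, ?_, fun x => ?_,
    (Ioc a b).indicator fun _ => K * C, memLp_indicator_const _ measurableSet_Ioc _
      (Or.inr (by simp)), fun j x => ?_⟩
  · have hi' := Finset.mem_range.1 hi
    exact hM _ _ (partitionPoint_mem hab hi'.le).1
      (monotone_partitionPoint hab _ (Nat.le_succ i)) (partitionPoint_mem hab hi').2
  · filter_upwards [hae] with ω hω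
    simpa only [hq1] using hω
  · refine Tendsto.comp (g := fun n => (q n).2 x) ?_ hns.tendsto_atTop
    by_cases hx : x ∈ Ioc a b
    · simp only [indicator_of_mem hx]
      rw [Metric.tendsto_atTop]
      intro ε hε
      have hC : 0 ≤ C := (abs_nonneg _).trans (hk x (Ioc_subset_Icc_self hx))
      obtain ⟨δ, hδ, hgδ⟩ := Metric.continuousWithinAt_iff.1 (hg x (Ioc_subset_Icc_self hx))
        (ε / (C + 1)) (by positivity)
      obtain ⟨N, hN⟩ := exists_nat_gt ((b - a) / δ)
      refine ⟨N + 1, fun n hn => ?_⟩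
      have hn0 : n ≠ 0 := by omega
      obtain ⟨y, hy, hyx, hqy⟩ := hin hn0 hx
      have hnpos : (0 : ℝ) < n := by exact_mod_cast Nat.pos_of_ne_zero hn0
      have hNn : (N : ℝ) ≤ n := by exact_mod_cast (by omega : N ≤ n)
      have hd : dist (g y) (g x) < ε / (C + 1) := by
        refine hgδ hy ?_
        rw [Real.dist_eq]
        refine hyx.trans_lt ?_
        rw [div_lt_iff₀ hnpos]
        rw [div_lt_iff₀ hδ] at hN
        nlinarith
      rw [hqy, Real.dist_eq, ← sub_mul, abs_mul]
      rw [Real.dist_eq] at hd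
      calc |g y - g x| * |k x| ≤ |g y - g x| * C :=
            mul_le_mul_of_nonneg_left (hk x (Ioc_subset_Icc_self hx)) (abs_nonneg _)
        _ ≤ ε / (C + 1) * C := mul_le_mul_of_nonneg_right hd.le hC
        _ < ε := by
            rw [div_mul_eq_mul_div, div_lt_iff₀ (by positivity)]
            nlinarith
    · simp [hout _ hx, indicator_of_notMem hx]
  · by_cases hx : x ∈ Ioc a b
    · rw [indicator_of_mem hx]
      have hK0 : 0 ≤ K := (norm_nonneg _).trans (hK a (left_mem_Icc.2 hab))
      have hC : 0 ≤ C := (abs_nonneg _).trans (hk x (Ioc_subset_Icc_self hx))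
      rcases eq_or_ne (ns j) 0 with h0 | h0
      · simp only [h0, hq2, Finset.range_zero, Finset.sum_empty, abs_zero]
        positivity
      · obtain ⟨y, hy, -, hqy⟩ := hin h0 hx
        rw [hqy, abs_mul]
        exact mul_le_mul (hK y hy) (hk x (Ioc_subset_Icc_self hx)) (abs_nonneg _) hK0
    · simp [hout _ hx, indicator_of_notMem hx]

end RiemannSum

/-! ### Variation of constants -/

/-- Pathwise variation of constants. If `M = X - ∫ (α + β X)` and `g' = -β g`, then the Riemann sums
of `∫ g dM` converge to the value `g X - ∫ g α` that integration by parts gives. -/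
theorem tendsto_riemannSum_variation_of_constants {α β g X : ℝ → ℝ} {a b : ℝ} (hab : a ≤ b)
    (hα : ContinuousOn α (Icc a b)) (hβ : ContinuousOn β (Icc a b))
    (hX : ContinuousOn X (Icc a b)) (hg : ContinuousOn g (Icc a b))
    (hg' : ∀ u v, a ≤ u → u ≤ v → v ≤ b → g v - g u = -∫ r in u..v, β r * g r) {M : ℝ → ℝ}
    (hM : ∀ u v, a ≤ u → u ≤ v → v ≤ b →
      M v - M u = X v - X u - ∫ r in u..v, (α r + β r * X r)) :
    Tendsto (fun n : ℕ => ∑ i ∈ Finset.range n, g (partitionPoint a b n i) *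
        (M (partitionPoint a b n (i + 1)) - M (partitionPoint a b n i)))
      atTop (𝓝 (g b * X b - g a * X a - ∫ r in a..b, g r * α r)) := by
  have hdrift : ContinuousOn (fun r => α r + β r * X r) (Icc a b) := hα.add (hβ.mul hX)
  have hβg : ContinuousOn (fun r => β r * g r) (Icc a b) := hβ.mul hg
  have hgα : ContinuousOn (fun r => g r * α r) (Icc a b) := hg.mul hα
  obtain ⟨K₁, hK₁⟩ := isCompact_Icc.exists_bound_of_continuousOn hdrift
  obtain ⟨K₂, hK₂⟩ := isCompact_Icc.exists_bound_of_continuousOn hβg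
  have hK₁0 : 0 ≤ K₁ := (norm_nonneg _).trans (hK₁ a (left_mem_Icc.2 hab))
  have hK₂0 : 0 ≤ K₂ := (norm_nonneg _).trans (hK₂ a (left_mem_Icc.2 hab))
  have hgu := isCompact_Icc.uniformContinuousOn_of_continuous hg
  have hXu := isCompact_Icc.uniformContinuousOn_of_continuous hX
  rw [Metric.uniformContinuousOn_iff] at hgu hXu
  rw [Metric.tendsto_atTop]
  intro ε hε
  have hba : 0 ≤ b - a := sub_nonneg.2 hab
  -- If `g` and `X` vary by less than `η` on each interval, the total error is at most `η K < ε`.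
  set K := (K₁ + K₂) * (b - a) with hK
  have hK0 : 0 ≤ K := by positivity
  set η := ε / (K + 1) with hη
  have hη0 : 0 < η := by positivity
  obtain ⟨δ₁, hδ₁, h1⟩ := hgu η hη0
  obtain ⟨δ₂, hδ₂, h2⟩ := hXu η hη0
  set δ := min δ₁ δ₂ with hδdef
  have hδ : 0 < δ := lt_min hδ₁ hδ₂
  obtain ⟨N, hN⟩ := exists_nat_gt ((b - a) / δ)
  refine ⟨N + 1, fun n hn => ?_⟩
  have hn0 : n ≠ 0 := by omega
  have hnpos : (0 : ℝ) < n := by exact_mod_cast Nat.pos_of_ne_zero hn0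
  have hNn : (N : ℝ) ≤ n := by exact_mod_cast (by omega : N ≤ n)
  have hmesh : (b - a) / n < δ := by
    rw [div_lt_iff₀ hnpos]
    rw [div_lt_iff₀ hδ] at hN
    nlinarith
  set u := partitionPoint a b n with hu
  have hmono : Monotone u := monotone_partitionPoint hab n
  have hu0 : u 0 = a := partitionPoint_zero a b n
  have hun : u n = b := partitionPoint_self a b hn0
  have hmem {i : ℕ} (hi : i ≤ n) : u i ∈ Icc a b := partitionPoint_mem hab hi
  have hsub {i : ℕ} (hi : i < n) : Icc (u i) (u (i + 1)) ⊆ Icc a b :=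
    Icc_subset_Icc (hmem hi.le).1 (hmem hi).2
  have hstep (i : ℕ) : u i ≤ u (i + 1) := hmono (Nat.le_succ i)
  have ii {f : ℝ → ℝ} (hf : ContinuousOn f (Icc a b)) {i : ℕ} (hi : i < n) :
      IntervalIntegrable f volume (u i) (u (i + 1)) :=
    (hf.mono (hsub hi)).intervalIntegrable_of_Icc (hstep i)
  -- The error on one interval of the partition.
  have key (i : ℕ) (hi : i < n) :
      (g (u (i + 1)) * X (u (i + 1)) - g (u i) * X (u i) -
          ∫ r in u i..u (i + 1), g r * α r) - g (u i) * (M (u (i + 1)) - M (u i)) =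
        ∫ r in u i..u (i + 1),
          ((g (u i) - g r) * (α r + β r * X r) + (X r - X (u (i + 1))) * (β r * g r)) := by
    have e1 : ∫ r in u i..u (i + 1),
        ((g (u i) - g r) * (α r + β r * X r) + (X r - X (u (i + 1))) * (β r * g r)) =
        ∫ r in u i..u (i + 1), (g (u i) * (α r + β r * X r) - g r * α r -
          X (u (i + 1)) * (β r * g r)) :=
      intervalIntegral.integral_congr fun r _ => by ring
    rw [e1, intervalIntegral.integral_sub (((ii hdrift hi).const_mul _).sub (ii hgα hi))
        ((ii hβg hi).const_mul _),
      intervalIntegral.integral_sub ((ii hdrift hi).const_mul _) (ii hgα hi),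
      intervalIntegral.integral_const_mul,
      intervalIntegral.integral_const_mul,
      hM _ _ (hmem hi.le).1 (hstep i) (hmem hi).2]
    have := hg' _ _ (hmem hi.le).1 (hstep i) (hmem hi).2
    linear_combination X (u (i + 1)) * this
  have hbound (i : ℕ) (hi : i < n) : ‖∫ r in u i..u (i + 1),
      ((g (u i) - g r) * (α r + β r * X r) + (X r - X (u (i + 1))) * (β r * g r))‖ ≤
      η * (K₁ + K₂) * (u (i + 1) - u i) := by
    have := intervalIntegral.norm_integral_le_of_norm_le_const (a := u i) (b := u (i + 1))
      (C := η * (K₁ + K₂)) (f := fun r =>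
        (g (u i) - g r) * (α r + β r * X r) + (X r - X (u (i + 1))) * (β r * g r)) ?_
    · rwa [abs_of_nonneg (sub_nonneg.2 (hstep i))] at this
    intro r hr
    rw [uIoc_of_le (hstep i)] at hr
    have hr' := hsub hi (Ioc_subset_Icc_self hr)
    have hs : u (i + 1) = u i + (b - a) / n := partitionPoint_succ a b n i
    have d1 : dist (g (u i)) (g r) < η := by
      refine h1 _ (hmem hi.le) _ hr' ?_
      rw [Real.dist_eq, abs_lt]
      have := min_le_left δ₁ δ₂
      constructor <;> linarith [hr.1, hr.2]
    have d2 : dist (X r) (X (u (i + 1))) < η := by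
      refine h2 _ hr' _ (hmem hi) ?_
      rw [Real.dist_eq, abs_lt]
      have := min_le_right δ₁ δ₂
      constructor <;> linarith [hr.1, hr.2]
    rw [Real.dist_eq] at d1 d2
    have b1 := hK₁ r hr'
    have b2 := hK₂ r hr'
    calc _ ≤ ‖(g (u i) - g r) * (α r + β r * X r)‖ + ‖(X r - X (u (i + 1))) * (β r * g r)‖ :=
          norm_add_le _ _
      _ ≤ η * K₁ + η * K₂ := by
          rw [norm_mul, norm_mul]
          exact add_le_add (mul_le_mul d1.le b1 (norm_nonneg _) hη0.le)
            (mul_le_mul d2.le b2 (norm_nonneg _) hη0.le)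
      _ = _ := by ring
  have htotal : (g b * X b - g a * X a - ∫ r in a..b, g r * α r) =
      ∑ i ∈ Finset.range n, (g (u (i + 1)) * X (u (i + 1)) - g (u i) * X (u i) -
          ∫ r in u i..u (i + 1), g r * α r) := by
    rw [Finset.sum_sub_distrib, Finset.sum_range_sub (fun i => g (u i) * X (u i)),
      intervalIntegral.sum_integral_adjacent_intervals (a := u) (n := n) fun i hi => ii hgα hi,
      hu0, hun]
  rw [dist_comm, Real.dist_eq, htotal, ← Finset.sum_sub_distrib,
    Finset.sum_congr rfl fun i hi => key i (Finset.mem_range.1 hi)]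
  calc _ ≤ ∑ i ∈ Finset.range n, η * (K₁ + K₂) * (u (i + 1) - u i) :=
        (Finset.abs_sum_le_sum_abs _ _).trans
          (Finset.sum_le_sum fun i hi => hbound i (Finset.mem_range.1 hi))
    _ = η * K := by
        rw [← Finset.mul_sum, Finset.sum_range_sub u, hu0, hun, hK]
        ring
    _ < ε := by
        rw [hη, div_mul_eq_mul_div, div_lt_iff₀ (by positivity)]
        nlinarith

namespace Params

variable (D : Params)

theorem φ_pos (t t' : ℝ) : 0 < D.φ t t' := Real.exp_pos _

theorem φ_self (t : ℝ) : D.φ t t = 1 := by simp [φ]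

theorem Icc_subset_Icc_T {u v : ℝ} (hu : u ∈ Icc 0 D.T) (hv : v ∈ Icc 0 D.T) :
    Icc u v ⊆ Icc 0 D.T := Icc_subset_Icc hu.1 hv.2

theorem intervalIntegrable_of_continuousOn {f : ℝ → ℝ} (hf : ContinuousOn f (Icc 0 D.T)) {u v : ℝ}
    (hu : u ∈ Icc 0 D.T) (hv : v ∈ Icc 0 D.T) : IntervalIntegrable f volume u v :=
  (hf.mono (uIcc_subset_Icc hu hv)).intervalIntegrable

theorem zero_mem : (0 : ℝ) ∈ Icc 0 D.T := left_mem_Icc.2 D.T_pos.le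

theorem T_mem : D.T ∈ Icc 0 D.T := right_mem_Icc.2 D.T_pos.le

theorem continuousOn_integral {f : ℝ → ℝ} (hf : ContinuousOn f (Icc 0 D.T)) {t : ℝ}
    (ht : t ∈ Icc 0 D.T) : ContinuousOn (fun v => ∫ u in t..v, f u) (Icc 0 D.T) := by
  have := intervalIntegral.continuousOn_primitive_interval' (μ := volume) (f := f) (b₁ := 0)
    (b₂ := D.T) (a := t) (D.intervalIntegrable_of_continuousOn hf D.zero_mem D.T_mem)
    (by rwa [uIcc_of_le D.T_pos.le])
  rwa [uIcc_of_le D.T_pos.le] at this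

theorem continuousOn_φ {t : ℝ} (ht : t ∈ Icc 0 D.T) : ContinuousOn (D.φ t) (Icc 0 D.T) :=
  Real.continuous_exp.comp_continuousOn (D.continuousOn_integral D.continuousOn_β ht)

theorem φ_mul_φ {t t' : ℝ} (ht : t ∈ Icc 0 D.T) (ht' : t' ∈ Icc 0 D.T) :
    D.φ 0 t * D.φ t t' = D.φ 0 t' := by
  rw [φ, φ, φ, ← Real.exp_add, intervalIntegral.integral_add_adjacent_intervals
    (D.intervalIntegrable_of_continuousOn D.continuousOn_β D.zero_mem ht)
    (D.intervalIntegrable_of_continuousOn D.continuousOn_β ht ht')]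

theorem φ_eq_div {t t' : ℝ} (ht : t ∈ Icc 0 D.T) (ht' : t' ∈ Icc 0 D.T) :
    D.φ t t' = D.φ 0 t' / D.φ 0 t := by
  rw [eq_div_iff (D.φ_pos 0 t).ne', mul_comm, D.φ_mul_φ ht ht']

theorem continuousOn_α_div_φ : ContinuousOn (fun u => D.α u / D.φ 0 u) (Icc 0 D.T) :=
  D.continuousOn_α.div (D.continuousOn_φ D.zero_mem) fun u _ => (D.φ_pos 0 u).ne'

theorem continuousOn_ζ_sq_div_φ_sq :
    ContinuousOn (fun u => D.ζ u ^ 2 / D.φ 0 u ^ 2) (Icc 0 D.T) :=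
  (D.continuousOn_ζ.pow 2).div ((D.continuousOn_φ D.zero_mem).pow 2)
    fun u _ => (pow_pos (D.φ_pos 0 u) 2).ne'

theorem inv_φ_sub_inv_φ {u v : ℝ} (hu : u ∈ Icc 0 D.T) (hv : v ∈ Icc 0 D.T) (huv : u ≤ v) :
    (D.φ 0 v)⁻¹ - (D.φ 0 u)⁻¹ = -∫ r in u..v, D.β r * (D.φ 0 r)⁻¹ := by
  have hc : ContinuousOn (fun r => (D.φ 0 r)⁻¹) (Icc 0 D.T) :=
    (D.continuousOn_φ D.zero_mem).inv₀ fun u _ => (D.φ_pos 0 u).ne'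
  have := intervalIntegral.integral_eq_sub_of_hasDerivAt_of_le huv
    (f := fun r => (D.φ 0 r)⁻¹) (f' := fun r => -(D.β r * (D.φ 0 r)⁻¹))
    (hc.mono (D.Icc_subset_Icc_T hu hv)) (fun r hr => ?_)
    (D.intervalIntegrable_of_continuousOn (D.continuousOn_β.mul hc).neg hu hv)
  · rw [← this, intervalIntegral.integral_neg]
  have hr' : r ∈ Ioo 0 D.T := ⟨hu.1.trans_lt hr.1, hr.2.trans_le hv.2⟩
  have hnhds : Icc 0 D.T ∈ 𝓝 r := Icc_mem_nhds hr'.1 hr'.2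
  have hd : HasDerivAt (fun v => ∫ u in (0 : ℝ)..v, D.β u) (D.β r) r :=
    intervalIntegral.integral_hasDerivAt_right
      (D.intervalIntegrable_of_continuousOn D.continuousOn_β D.zero_mem (Ioo_subset_Icc_self hr'))
      (ContinuousOn.stronglyMeasurableAtFilter isOpen_Ioo
        (D.continuousOn_β.mono Ioo_subset_Icc_self) r hr')
      (D.continuousOn_β.continuousAt hnhds)
  have := hd.exp.inv (Real.exp_pos _).ne'
  refine this.congr_deriv ?_
  simp only [φ]
  have := (Real.exp_pos (∫ u in (0 : ℝ)..r, D.β u)).ne'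
  field_simp

theorem h_eq (t : ℝ) : D.h t = ∫ u in (0 : ℝ)..t, D.ζ u ^ 2 / D.φ 0 u ^ 2 := by
  rw [h, r₁, r₂, mul_div_cancel_left₀ _ (D.φ_pos 0 t).ne']

theorem h_zero : D.h 0 = 0 := by simp [h_eq]

theorem h_sub_h {u v : ℝ} (hu : u ∈ Icc 0 D.T) (hv : v ∈ Icc 0 D.T) :
    D.h v - D.h u = ∫ r in u..v, D.ζ r ^ 2 / D.φ 0 r ^ 2 := by
  rw [h_eq, h_eq, intervalIntegral.integral_interval_sub_left]
  · exact D.intervalIntegrable_of_continuousOn D.continuousOn_ζ_sq_div_φ_sq D.zero_mem hv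
  · exact D.intervalIntegrable_of_continuousOn D.continuousOn_ζ_sq_div_φ_sq D.zero_mem hu

theorem strictMonoOn_h : StrictMonoOn D.h (Icc 0 D.T) := by
  intro u hu v hv huv
  rw [← sub_pos, D.h_sub_h hu hv]
  refine intervalIntegral.intervalIntegral_pos_of_pos_on
    (D.intervalIntegrable_of_continuousOn D.continuousOn_ζ_sq_div_φ_sq hu hv) (fun r hr => ?_) huv
  have := D.ζ_pos r ⟨hu.1.trans hr.1.le, hr.2.le.trans hv.2⟩
  have := D.φ_pos 0 r
  positivity

theorem continuousOn_h : ContinuousOn D.h (Icc 0 D.T) := by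
  have : D.h = fun t => ∫ u in (0 : ℝ)..t, D.ζ u ^ 2 / D.φ 0 u ^ 2 := funext D.h_eq
  rw [this]
  exact D.continuousOn_integral D.continuousOn_ζ_sq_div_φ_sq D.zero_mem

theorem hT_pos : 0 < D.hT := by
  have := D.strictMonoOn_h D.zero_mem D.T_mem D.T_pos
  rwa [h_zero] at this

theorem m_eq (t : ℝ) : D.m t = D.φ 0 t * ∫ u in (0 : ℝ)..t, D.α u / D.φ 0 u := by
  simp [m, condMean]

/-- The conditional mean in terms of quantities relative to the origin of time. -/
theorem condMean_eq {t t' : ℝ} (x : ℝ) (ht : t ∈ Icc 0 D.T) (ht' : t' ∈ Icc 0 D.T) :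
    D.condMean t x t' = D.m t' + D.φ 0 t' * ((x - D.m t) / D.φ 0 t) := by
  have hφ := (D.φ_pos 0 t).ne'
  have e : ∫ u in t..t', D.α u / D.φ t u = D.φ 0 t * ∫ u in t..t', D.α u / D.φ 0 u := by
    rw [← intervalIntegral.integral_const_mul]
    refine intervalIntegral.integral_congr fun u hu => ?_
    have hu' := uIcc_subset_Icc ht ht' hu
    have := (D.φ_pos 0 u).ne'
    simp only [D.φ_eq_div ht hu']
    field_simp
  have e2 : ∫ u in t..t', D.α u / D.φ 0 u =
      (∫ u in (0 : ℝ)..t', D.α u / D.φ 0 u) - ∫ u in (0 : ℝ)..t, D.α u / D.φ 0 u := by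
    rw [intervalIntegral.integral_interval_sub_left]
    · exact D.intervalIntegrable_of_continuousOn D.continuousOn_α_div_φ D.zero_mem ht'
    · exact D.intervalIntegrable_of_continuousOn D.continuousOn_α_div_φ D.zero_mem ht
  rw [condMean, e, e2, m_eq, m_eq, D.φ_eq_div ht ht']
  field_simp
  ring

theorem condVar_eq {t t' : ℝ} (ht : t ∈ Icc 0 D.T) (ht' : t' ∈ Icc 0 D.T) :
    D.condVar t t' = D.φ 0 t' ^ 2 * (D.h t' - D.h t) := by
  have hφ := (D.φ_pos 0 t).ne'
  rw [condVar, D.h_sub_h ht ht']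
  have e : ∫ u in t..t', D.ζ u ^ 2 / D.φ t u ^ 2 =
      D.φ 0 t ^ 2 * ∫ u in t..t', D.ζ u ^ 2 / D.φ 0 u ^ 2 := by
    rw [← intervalIntegral.integral_const_mul]
    refine intervalIntegral.integral_congr fun u hu => ?_
    have hu' := uIcc_subset_Icc ht ht' hu
    have := (D.φ_pos 0 u).ne'
    simp only [D.φ_eq_div ht hu']
    field_simp
  rw [e, D.φ_eq_div ht ht']
  field_simp

end Params

theorem pathAt_of_mem {L : ℝ} (ω : PathSpace L) {r : ℝ} (hr : r ∈ Icc 0 L) :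
    pathAt ω r = ω ⟨r, hr⟩ := by
  simp [pathAt, hr]

theorem continuousOn_pathAt {L : ℝ} (ω : PathSpace L) : ContinuousOn (pathAt ω) (Icc 0 L) := by
  rw [continuousOn_iff_continuous_domRestrict]
  refine ω.continuous.congr fun r => ?_
  rw [domRestrict_apply, pathAt_of_mem ω r.2]

section Solution

variable {D : Params} {Ω : Type*} [MeasurableSpace Ω] {μ : Measure Ω}
  {B : ℝ≥0 → Ω → ℝ} {t x : ℝ} {X : Ω → PathSpace (D.T - t)}

theorem isWienerIntegral_iff {ζ : ℝ → ℝ} {a b : ℝ} {I : Ω → ℝ} :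
    IsWienerIntegral μ B ζ a b I ↔ TendstoInMeasure μ (fun (n : ℕ) ω => ∑ i ∈ Finset.range n,
      ζ (partitionPoint a b n i) * (B (partitionPoint a b n (i + 1)).toNNReal ω -
        B (partitionPoint a b n i).toNNReal ω)) atTop I := by
  simp only [IsWienerIntegral, partitionPoint, Nat.cast_add, Nat.cast_one]

/-- The initial condition is the equation at elapsed time `0`, where all the Riemann sums vanish. -/
theorem Params.IsSolution.apply_zero (hX : D.IsSolution μ B t x X) (ht : t ∈ Icc 0 D.T) :
    ∀ᵐ ω ∂μ, pathAt (X ω) 0 = x := by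
  have h0 : (0 : ℝ) ∈ Icc 0 (D.T - t) := ⟨le_rfl, sub_nonneg.2 ht.2⟩
  have h := hX.sde ⟨0, h0⟩
  have h' : TendstoInMeasure μ (fun (_ : ℕ) (_ : Ω) => (0 : ℝ)) atTop
      (fun ω => X ω ⟨0, h0⟩ - x -
        ∫ r in (0 : ℝ)..0, (D.α (t + r) + D.β (t + r) * pathAt (X ω) r)) := by
    simpa [isWienerIntegral_iff, partitionPoint] using h
  have hz : TendstoInMeasure μ (fun (_ : ℕ) (_ : Ω) => (0 : ℝ)) atTop (fun _ => (0 : ℝ)) := by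
    intro ε hε
    simp [hε.not_ge]
  filter_upwards [tendstoInMeasure_ae_unique h' hz] with ω hω
  rw [intervalIntegral.integral_same] at hω
  rw [pathAt_of_mem _ h0]
  linarith

/-- The noise of the equation, recovered from the path of the solution, at the time `v ≥ t`. -/
noncomputable def noise (D : Params) (t x : ℝ) (ω : PathSpace (D.T - t)) (v : ℝ) : ℝ :=
  pathAt ω (v - t) - x - ∫ r in t..v, (D.α r + D.β r * pathAt ω (r - t))

theorem continuousOn_pathAt_sub (ω : PathSpace (D.T - t)) :
    ContinuousOn (fun r => pathAt ω (r - t)) (Icc t D.T) :=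
  (continuousOn_pathAt ω).comp (by fun_prop) fun r hr => ⟨by linarith [hr.1], by linarith [hr.2]⟩

theorem noise_sub_noise (ht : t ∈ Icc 0 D.T) (ω : PathSpace (D.T - t)) {u v : ℝ}
    (hu : u ∈ Icc t D.T) (hv : v ∈ Icc t D.T) :
    noise D t x ω v - noise D t x ω u = pathAt ω (v - t) - pathAt ω (u - t) -
      ∫ r in u..v, (D.α r + D.β r * pathAt ω (r - t)) := by
  have hsub : Icc t D.T ⊆ Icc 0 D.T := Icc_subset_Icc_left ht.1
  have hc : ContinuousOn (fun r => D.α r + D.β r * pathAt ω (r - t)) (Icc t D.T) :=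
    (D.continuousOn_α.mono hsub).add ((D.continuousOn_β.mono hsub).mul (continuousOn_pathAt_sub ω))
  have ii {w : ℝ} (hw : w ∈ Icc t D.T) :
      IntervalIntegrable (fun r => D.α r + D.β r * pathAt ω (r - t)) volume t w :=
    (hc.mono (uIcc_subset_Icc (left_mem_Icc.2 ht.2) hw)).intervalIntegrable
  rw [noise, noise, ← intervalIntegral.integral_interval_sub_left (ii hv) (ii hu)]
  ring

/-- The noise up to time `v` is the Wiener integral `∫_t^v ζ dB`. -/
theorem noise_mem (hX : D.IsSolution μ B t x X)
    (ht : t ∈ Icc 0 D.T) {v : ℝ} (hv : v ∈ Icc t D.T) :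
    (fun ω => noise D t x (X ω) v, (Ioc t v).indicator D.ζ) ∈
      limitClosure μ (brownianFamily B) := by
  have hvt : v - t ∈ Icc 0 (D.T - t) := ⟨by linarith [hv.1], by linarith [hv.2]⟩
  have h := isWienerIntegral_iff.1 (hX.sde ⟨v - t, hvt⟩)
  have e : (fun ω => X ω ⟨v - t, hvt⟩ - x -
      ∫ r in (0 : ℝ)..(v - t), (D.α (t + r) + D.β (t + r) * pathAt (X ω) r)) =
      fun ω => noise D t x (X ω) v := by
    ext ω
    rw [noise, pathAt_of_mem _ hvt]
    congr 1
    have := intervalIntegral.integral_comp_add_left (a := 0) (b := v - t)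
      (fun r => D.α r + D.β r * pathAt (X ω) (r - t)) t
    simpa using this
  simp only [add_sub_cancel] at h
  rw [e] at h
  have := mem_limitClosure_of_riemannSum (R := brownianFamily B) (k := fun _ => 1)
    (M := fun v => B v.toNNReal) hv.1
    (fun u w hu huw _ => sub_mem_brownianFamily B (ht.1.trans hu) huw)
    (D.continuousOn_ζ.mono (Icc_subset_Icc ht.1 hv.2)) (C := 1) (by simp) h
  simpa using this

/-- The solution, discounted by `φ` and without its drift, is the Wiener integral of `ζ / φ`. -/
theorem discounted_mem [IsProbabilityMeasure μ] (hB : IsPreBrownianReal B μ)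
    (hX : D.IsSolution μ B t x X) (ht : t ∈ Icc 0 D.T) {v : ℝ} (hv : v ∈ Icc t D.T) :
    (fun ω => pathAt (X ω) (v - t) / D.φ 0 v - pathAt (X ω) 0 / D.φ 0 t -
        ∫ r in t..v, D.α r / D.φ 0 r, (Ioc t v).indicator fun r => D.ζ r / D.φ 0 r) ∈
      limitClosure μ (limitClosure μ (brownianFamily B)) := by
  have hiso := (isIsonormal_brownianFamily hB).limitClosure
  have hsub : Icc t v ⊆ Icc 0 D.T := Icc_subset_Icc ht.1 hv.2
  have hsub' : Icc t v ⊆ Icc t D.T := Icc_subset_Icc_right hv.2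
  have hg : ContinuousOn (fun r => (D.φ 0 r)⁻¹) (Icc t v) :=
    ((D.continuousOn_φ D.zero_mem).inv₀ fun u _ => (D.φ_pos 0 u).ne').mono hsub
  have hlim (ω : Ω) := tendsto_riemannSum_variation_of_constants hv.1
    (D.continuousOn_α.mono hsub) (D.continuousOn_β.mono hsub)
    ((continuousOn_pathAt_sub (X ω)).mono hsub') hg
    (fun u w hu huw hw => D.inv_φ_sub_inv_φ (hsub ⟨hu, huw.trans hw⟩) (hsub ⟨hu.trans huw, hw⟩) huw)
    (M := noise D t x (X ω))
    (fun u w hu huw hw => noise_sub_noise ht (X ω) (hsub' ⟨hu, huw.trans hw⟩)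
      (hsub' ⟨hu.trans huw, hw⟩))
  have hinc (u w : ℝ) (hu : t ≤ u) (huw : u ≤ w) (hw : w ≤ v) :
      (((fun w ω => noise D t x (X ω) w) : ℝ → Ω → ℝ) w - (fun ω => noise D t x (X ω) u),
        (Ioc u w).indicator D.ζ) ∈ limitClosure μ (brownianFamily B) := by
    convert (limitClosure μ (brownianFamily B)).sub_mem
      (noise_mem hX ht (hsub' ⟨hu.trans huw, hw⟩))
      (noise_mem hX ht (hsub' ⟨hu, huw.trans hw⟩)) using 1
    refine Prod.ext rfl (funext fun y => ?_)
    simp only [Prod.snd_sub, Pi.sub_apply, Set.indicator, mem_Ioc]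
    split_ifs <;> grind
  obtain ⟨C, hC⟩ := isCompact_Icc.exists_bound_of_continuousOn (D.continuousOn_ζ.mono hsub)
  have hmeas {w : ℝ} (hw : w ∈ Icc t v) : AEMeasurable (fun ω => noise D t x (X ω) w) μ :=
    (hiso _ (noise_mem hX ht (hsub' hw))).1
  have := mem_limitClosure_of_riemannSum hv.1 hinc hg hC
    (tendstoInMeasure_of_tendsto_ae (μ := μ) (fun n => ?_) (ae_of_all _ hlim))
  · convert this using 2
    · ext ω
      simp only [div_eq_inv_mul, sub_self]
    · ext r
      simp only [div_eq_inv_mul]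
  · refine (Finset.aemeasurable_fun_sum _ fun i hi => ?_).aestronglyMeasurable
    have hi' := Finset.mem_range.1 hi
    exact ((hmeas (partitionPoint_mem hv.1 hi')).sub
      (hmeas (partitionPoint_mem hv.1 hi'.le))).const_mul _

end Solution

/-! ### The time change on paths -/

section TimeChange

variable {D : Params} {t s : ℝ}

theorem add_mem_Icc_T (ht : t ∈ Icc 0 D.T) (u : Icc (0 : ℝ) (D.T - t)) : t + u ∈ Icc 0 D.T :=
  ⟨add_nonneg ht.1 u.2.1, by linarith [u.2.2]⟩

/-- The time change `u ↦ h(t + u) / h(T) - s` from `[0, T - t]` to `[0, 1 - s]`, where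
`s = h(t) / h(T)`. -/
noncomputable def clock (D : Params) (ht : t ∈ Icc 0 D.T) (hs : s = D.h t / D.hT) :
    Icc (0 : ℝ) (D.T - t) ≃o Icc (0 : ℝ) (1 - s) :=
  StrictMono.orderIsoOfSurjective
    (fun u => ⟨D.h (t + u) / D.hT - s, by
      have h1 := D.strictMonoOn_h.monotoneOn ht (add_mem_Icc_T ht u) (by linarith [u.2.1])
      have h2 := D.strictMonoOn_h.monotoneOn (add_mem_Icc_T ht u) D.T_mem (add_mem_Icc_T ht u).2
      rw [hs]
      exact ⟨sub_nonneg.2 (div_le_div_of_nonneg_right h1 D.hT_pos.le),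
        sub_le_sub_right ((div_le_one D.hT_pos).2 h2) _⟩⟩)
    (fun u v huv => by
      have h := D.strictMonoOn_h (add_mem_Icc_T ht u) (add_mem_Icc_T ht v)
        (add_lt_add_right (a := t) (Subtype.coe_lt_coe.2 huv))
      exact Subtype.coe_lt_coe.1 (sub_lt_sub_right (div_lt_div_of_pos_right h D.hT_pos) _))
    (fun r => by
      have hT := D.hT_pos
      have hr1 : D.h t ≤ (s + r) * D.hT := by
        have hst : s * D.hT = D.h t := by rw [hs, div_mul_cancel₀ _ hT.ne']
        rw [add_mul, hst]
        have := mul_nonneg r.2.1 hT.le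
        linarith
      have hr2 : (s + r) * D.hT ≤ D.h D.T := by
        have : s + r ≤ 1 := by linarith [r.2.2]
        calc (s + r) * D.hT ≤ 1 * D.hT := mul_le_mul_of_nonneg_right this hT.le
          _ = D.h D.T := one_mul _
      obtain ⟨v, hv, hvr⟩ := intermediate_value_Icc ht.2
        (D.continuousOn_h.mono (Icc_subset_Icc_left ht.1)) ⟨hr1, hr2⟩
      refine ⟨⟨v - t, by linarith [hv.1], by linarith [hv.2]⟩, Subtype.ext ?_⟩
      simp only [add_sub_cancel, hvr]
      rw [mul_div_cancel_right₀ _ hT.ne']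
      ring)

theorem add_clock (ht : t ∈ Icc 0 D.T) (hs : s = D.h t / D.hT) (u : Icc (0 : ℝ) (D.T - t)) :
    s + (clock D ht hs u : ℝ) = D.h (t + u) / D.hT := by
  change s + (D.h (t + u) / D.hT - s) = _
  ring

theorem eq_clock_iff (ht : t ∈ Icc 0 D.T) (hs : s = D.h t / D.hT) (u : Icc (0 : ℝ) (D.T - t))
    (r : Icc (0 : ℝ) (1 - s)) : s + (r : ℝ) = D.h (t + u) / D.hT ↔ r = clock D ht hs u := by
  rw [← add_clock ht hs, add_right_inj, Subtype.coe_inj]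

theorem continuous_clock (ht : t ∈ Icc 0 D.T) (hs : s = D.h t / D.hT) :
    Continuous (clock D ht hs) := (clock D ht hs).continuous

theorem clock_terminal (ht : t ∈ Icc 0 D.T) (hs : s = D.h t / D.hT)
    (hL : D.T - t ∈ Icc 0 (D.T - t)) (hL' : 1 - s ∈ Icc 0 (1 - s)) :
    clock D ht hs ⟨D.T - t, hL⟩ = ⟨1 - s, hL'⟩ := by
  refine ((eq_clock_iff ht hs _ _).1 ?_).symm
  have : D.h D.T / D.hT = 1 := div_self D.hT_pos.ne'
  simp [this]

theorem Params.hInv_h {v : ℝ} (hv : v ∈ Icc 0 D.T) : D.hInv (D.h v) = v :=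
  D.strictMonoOn_h.injOn.leftInvOn_invFunOn hv

/-- The gain function at the clock time `h(v) / h(T)`, in terms of the original time `v`. -/
theorem Params.G_eq {v : ℝ} (hv : v ∈ Icc 0 D.T) (y : ℝ) :
    D.G (D.h v / D.hT) y = D.m v + D.φ 0 v * √D.hT * y := by
  rw [Params.G, Params.a₀, Params.a₁, div_mul_cancel₀ _ D.hT_pos.ne', Params.hInv_h hv]

theorem Params.scale_pos (D : Params) (v : ℝ) : 0 < D.φ 0 v * √D.hT :=
  mul_pos (D.φ_pos 0 v) (Real.sqrt_pos.2 D.hT_pos)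

theorem Params.continuousOn_m : ContinuousOn D.m (Icc 0 D.T) := by
  have : D.m = fun t => D.φ 0 t * ∫ u in (0 : ℝ)..t, D.α u / D.φ 0 u := funext D.m_eq
  rw [this]
  exact (D.continuousOn_φ D.zero_mem).mul
    (D.continuousOn_integral D.continuousOn_α_div_φ D.zero_mem)

theorem measurable_path_iff {L : ℝ} {Ω : Type*} [MeasurableSpace Ω] {f : Ω → PathSpace L} :
    Measurable f ↔ ∀ u, Measurable fun ω => f ω u := by
  rw [measurable_comap_iff, measurable_pi_iff]
  rfl

theorem continuous_comp_add (ht : t ∈ Icc 0 D.T) {f : ℝ → ℝ} (hf : ContinuousOn f (Icc 0 D.T)) :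
    Continuous fun u : Icc (0 : ℝ) (D.T - t) => f (t + u) :=
  hf.comp_continuous (by fun_prop) fun u => add_mem_Icc_T ht u

/-- The correspondence between the paths of `(X_{t+u})_u` and those of `(Y_{s+r})_r`. -/
noncomputable def pathEquiv (D : Params) (ht : t ∈ Icc 0 D.T) (hs : s = D.h t / D.hT) :
    PathSpace (D.T - t) ≃ᵐ PathSpace (1 - s) where
  toFun ω := ⟨fun r => (ω ((clock D ht hs).symm r) - D.m (t + (clock D ht hs).symm r)) /
      (D.φ 0 (t + (clock D ht hs).symm r) * √D.hT), by
    have hc : Continuous (clock D ht hs).symm := (clock D ht hs).symm.continuous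
    refine ((ω.continuous.comp hc).sub ((continuous_comp_add ht D.continuousOn_m).comp hc)).div
      (((continuous_comp_add ht (D.continuousOn_φ D.zero_mem)).comp hc).mul continuous_const)
      fun r => (D.scale_pos _).ne'⟩
  invFun η := ⟨fun u => D.m (t + u) + D.φ 0 (t + u) * √D.hT * η (clock D ht hs u),
    (continuous_comp_add ht D.continuousOn_m).add
      (((continuous_comp_add ht (D.continuousOn_φ D.zero_mem)).mul continuous_const).mul
        (η.continuous.comp (continuous_clock ht hs)))⟩
  left_inv ω := by
    ext u
    have := (D.scale_pos (t + u)).ne'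
    simp only [ContinuousMap.coe_mk, OrderIso.symm_apply_apply]
    rw [mul_div_cancel₀ _ this]
    ring
  right_inv η := by
    ext r
    have := (D.scale_pos (t + (clock D ht hs).symm r)).ne'
    simp only [ContinuousMap.coe_mk, OrderIso.apply_symm_apply, add_sub_cancel_left]
    rw [mul_div_cancel_left₀ _ this]
  measurable_toFun := measurable_path_iff.2 fun r =>
    ((measurable_coord _).sub_const _).div_const _
  measurable_invFun := measurable_path_iff.2 fun u =>
    ((measurable_coord _).const_mul _).const_add _

theorem pathEquiv_apply (ht : t ∈ Icc 0 D.T) (hs : s = D.h t / D.hT) (ω : PathSpace (D.T - t))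
    (r : Icc (0 : ℝ) (1 - s)) : pathEquiv D ht hs ω r =
      (ω ((clock D ht hs).symm r) - D.m (t + (clock D ht hs).symm r)) /
        (D.φ 0 (t + (clock D ht hs).symm r) * √D.hT) := rfl

theorem pathEquiv_symm_apply (ht : t ∈ Icc 0 D.T) (hs : s = D.h t / D.hT)
    (η : PathSpace (1 - s)) (u : Icc (0 : ℝ) (D.T - t)) : (pathEquiv D ht hs).symm η u =
      D.m (t + u) + D.φ 0 (t + u) * √D.hT * η (clock D ht hs u) := rfl

theorem pathsCorrespond_iff (ht : t ∈ Icc 0 D.T) (hs : s = D.h t / D.hT)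
    (ω : PathSpace (D.T - t)) (η : PathSpace (1 - s)) :
    PathsCorrespond D t s ω η ↔ ω = (pathEquiv D ht hs).symm η := by
  simp only [PathsCorrespond, eq_clock_iff ht hs, forall_eq, DFunLike.ext_iff,
    pathEquiv_symm_apply, add_clock, Params.G_eq (add_mem_Icc_T ht _)]

theorem pathsCorrespond_pathEquiv (ht : t ∈ Icc 0 D.T) (hs : s = D.h t / D.hT)
    (ω : PathSpace (D.T - t)) : PathsCorrespond D t s ω (pathEquiv D ht hs ω) := by
  rw [pathsCorrespond_iff ht hs, MeasurableEquiv.symm_apply_apply]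

theorem timesCorrespond_iff (ht : t ∈ Icc 0 D.T) (hs : s = D.h t / D.hT)
    (τ : PathSpace (D.T - t) → Icc (0 : ℝ) (D.T - t))
    (σ : PathSpace (1 - s) → Icc (0 : ℝ) (1 - s)) : TimesCorrespond D t s τ σ ↔
      ∀ η, σ η = clock D ht hs (τ ((pathEquiv D ht hs).symm η)) := by
  simp only [TimesCorrespond, pathsCorrespond_iff ht hs, eq_clock_iff ht hs]
  constructor
  · intro h η
    exact h _ η rfl
  · rintro h _ η rfl
    exact h η

end TimeChange

/-! ### The law of the unconditioned process -/

/-- A finite measure on path space is determined by its finite-dimensional marginals. -/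
theorem pathMeasure_ext {L : ℝ} {P P' : Measure (PathSpace L)} [IsFiniteMeasure P]
    (h : ∀ I : Finset (Icc (0 : ℝ) L),
      P.map (fun ω (i : I) => ω i) = P'.map (fun ω (i : I) => ω i)) : P = P' := by
  have hm : Measurable (fun (ω : PathSpace L) (u : Icc (0 : ℝ) L) => ω u) := comap_measurable _
  have key : P.map (fun ω u => ω u) = P'.map (fun ω u => ω u) := by
    refine IsProjectiveLimit.unique (P := fun I => P.map (fun ω (i : I) => ω i)) ?_ ?_
    · intro I
      rw [Measure.map_map (by fun_prop) hm]
      rfl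
    · intro I
      rw [Measure.map_map (by fun_prop) hm]
      exact (h I).symm
  ext A hA
  obtain ⟨A', hA', rfl⟩ := hA
  rw [← Measure.map_apply hm hA', ← Measure.map_apply hm hA', key]

section Law

variable {D : Params} {t x s y : ℝ}

/-- The standardized path of a solution is its starting point plus a multiple of the discounted
process without its drift, which is a Wiener integral. -/
theorem pathEquiv_solution_apply (ht : t ∈ Icc 0 D.T) (hs : s = D.h t / D.hT)
    (hy : y = (x - D.m t) / (D.φ 0 t * √D.hT)) {ω : PathSpace (D.T - t)} (hω : pathAt ω 0 = x)
    (r : Icc (0 : ℝ) (1 - s)) :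
    pathEquiv D ht hs ω r = y + (√D.hT)⁻¹ *
      (pathAt ω (t + (clock D ht hs).symm r - t) / D.φ 0 (t + (clock D ht hs).symm r) -
        pathAt ω 0 / D.φ 0 t - ∫ u in t..t + (clock D ht hs).symm r, D.α u / D.φ 0 u) := by
  rw [pathEquiv_apply]
  set u := (clock D ht hs).symm r
  have hv := add_mem_Icc_T ht u
  have h1 := (D.φ_pos 0 t).ne'
  have h2 := (D.φ_pos 0 (t + u)).ne'
  have h3 := (Real.sqrt_pos.2 D.hT_pos).ne'
  have e2 : ∫ u in t..t + u, D.α u / D.φ 0 u =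
      (∫ u in (0 : ℝ)..t + u, D.α u / D.φ 0 u) - ∫ u in (0 : ℝ)..t, D.α u / D.φ 0 u := by
    rw [intervalIntegral.integral_interval_sub_left]
    · exact D.intervalIntegrable_of_continuousOn D.continuousOn_α_div_φ D.zero_mem hv
    · exact D.intervalIntegrable_of_continuousOn D.continuousOn_α_div_φ D.zero_mem ht
  rw [add_sub_cancel_left, pathAt_of_mem ω u.2, e2, hy, hω, D.m_eq, D.m_eq]
  field_simp
  ring

theorem integral_indicator_mul_indicator_Ioc (f : ℝ → ℝ) (a b c : ℝ) :
    ∫ x, (Ioc a b).indicator f x * (Ioc a c).indicator f x = ∫ x in Ioc a (min b c), f x ^ 2 := by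
  simp_rw [← Set.inter_indicator_mul, Ioc_inter_Ioc, sup_idem]
  rw [integral_indicator measurableSet_Ioc]
  simp only [sq]

/-- The time change and the standardization turn the unconditioned process into a Brownian
motion. -/
theorem map_pathEquiv_solution {Ω : Type*} [MeasurableSpace Ω] {μ : Measure Ω}
    [IsProbabilityMeasure μ] {B : ℝ≥0 → Ω → ℝ} (hB : IsPreBrownianReal B μ)
    {X : Ω → PathSpace (D.T - t)} (hX : D.IsSolution μ B t x X)
    {Ω' : Type*} [MeasurableSpace Ω'] {μ' : Measure Ω'} [IsProbabilityMeasure μ']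
    {B' : ℝ≥0 → Ω' → ℝ} (hB' : IsPreBrownianReal B' μ')
    {Y : Ω' → PathSpace (1 - s)} (hY : IsBrownianFrom μ' B' s y Y)
    (ht : t ∈ Icc 0 D.T) (hs : s = D.h t / D.hT)
    (hy : y = (x - D.m t) / (D.φ 0 t * √D.hT)) :
    (μ.map X).map (pathEquiv D ht hs) = μ'.map Y := by
  have hs0 : 0 ≤ s := by
    rw [hs]
    have := D.strictMonoOn_h.monotoneOn D.zero_mem ht ht.1
    rw [D.h_zero] at this
    exact div_nonneg this D.hT_pos.le
  have hR := (isIsonormal_brownianFamily hB).limitClosure.limitClosure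
  have hR' := isIsonormal_brownianFamily hB'
  have := Measure.isProbabilityMeasure_map hX.aemeasurable
  have := Measure.isProbabilityMeasure_map
    ((pathEquiv D ht hs).measurable.aemeasurable (μ := μ.map X))
  have hcoord {L : ℝ} (I : Finset (Icc (0 : ℝ) L)) :
      Measurable (fun (ω : PathSpace L) (i : I) => ω i) :=
    measurable_pi_lambda _ fun i => measurable_coord _
  refine pathMeasure_ext fun I => ?_
  -- The pairs of random variables and functions that represent the two processes.
  set v : I → ℝ := fun r => t + (clock D ht hs).symm r with hv
  have hvmem (r : I) : v r ∈ Icc t D.T :=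
    ⟨le_add_of_nonneg_right ((clock D ht hs).symm r).2.1, (add_mem_Icc_T ht _).2⟩
  set p : I → (Ω → ℝ) × (ℝ → ℝ) := fun r => (√D.hT)⁻¹ •
    (fun ω => pathAt (X ω) (v r - t) / D.φ 0 (v r) - pathAt (X ω) 0 / D.φ 0 t -
        ∫ r in t..v r, D.α r / D.φ 0 r, (Ioc t (v r)).indicator fun r => D.ζ r / D.φ 0 r) with hp
  set p' : I → (Ω' → ℝ) × (ℝ → ℝ) := fun r =>
    (B' (s + (r : Icc (0 : ℝ) (1 - s))).toNNReal - B' s.toNNReal,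
      (Ioc s (s + (r : Icc (0 : ℝ) (1 - s)))).indicator fun _ => (1 : ℝ)) with hp'
  have hpmem (r : I) : p r ∈ limitClosure μ (limitClosure μ (brownianFamily B)) :=
    Submodule.smul_mem _ _ (discounted_mem hB hX ht (hvmem r))
  have hpmem' (r : I) : p' r ∈ brownianFamily B' :=
    sub_mem_brownianFamily B' hs0 (le_add_of_nonneg_right r.1.2.1)
  have hmin (i j : I) : ∃ u : Icc (0 : ℝ) (D.T - t), min (v i) (v j) = t + u ∧
      clock D ht hs u = min i.1 j.1 := by
    refine ⟨(clock D ht hs).symm (min i.1 j.1), ?_, by simp⟩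
    rw [hv, (clock D ht hs).symm.monotone.map_min]
    exact min_add_add_left _ _ _
  -- Both inner products are the clock time elapsed up to the earlier of the two times.
  have hinner (i j : I) : ∫ z, (p i).2 z * (p j).2 z = ∫ z, (p' i).2 z * (p' j).2 z := by
    obtain ⟨u, hu, hcu⟩ := hmin i j
    have e1 : ∫ z, (p i).2 z * (p j).2 z = D.hT⁻¹ * (D.h (t + u) - D.h t) := by
      have e (z : ℝ) : (p i).2 z * (p j).2 z = (√D.hT)⁻¹ * (√D.hT)⁻¹ *
          ((Ioc t (v i)).indicator (fun r => D.ζ r / D.φ 0 r) z *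
            (Ioc t (v j)).indicator (fun r => D.ζ r / D.φ 0 r) z) := mul_mul_mul_comm _ _ _ _
      simp_rw [e]
      rw [integral_const_mul, integral_indicator_mul_indicator_Ioc, ← mul_inv,
        Real.mul_self_sqrt D.hT_pos.le, hu, D.h_sub_h ht (add_mem_Icc_T ht u),
        intervalIntegral.integral_of_le (le_add_of_nonneg_right u.2.1)]
      simp only [div_pow]
    have e2 : ∫ z, (p' i).2 z * (p' j).2 z = min (i.1 : ℝ) j.1 := by
      simp only [hp']
      rw [integral_indicator_mul_indicator_Ioc, min_add_add_left]
      have : (0 : ℝ) ≤ min (i.1 : ℝ) j.1 := le_min i.1.2.1 j.1.2.1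
      simp [this]
    have e3 : min (i.1 : ℝ) j.1 = (clock D ht hs u : ℝ) := by
      rw [hcu]
      exact ((Subtype.mono_coe _).map_min).symm
    have := add_clock ht hs u
    rw [e1, e2, e3]
    have h4 : (clock D ht hs u : ℝ) = D.h (t + u) / D.hT - D.h t / D.hT := by
      linarith
    rw [h4]
    ring
  have hlaw := hR.map_eq_map hR' hpmem hpmem' hinner
  have hadd : Measurable (fun (w : I → ℝ) (i : I) => y + w i) := by fun_prop
  have hl : ((μ.map X).map (pathEquiv D ht hs)).map (fun ω (i : I) => ω i) =
      (μ.map (fun ω i => (p i).1 ω)).map (fun w i => y + w i) := by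
    rw [Measure.map_map (hcoord I) (pathEquiv D ht hs).measurable,
      AEMeasurable.map_map_of_aemeasurable
        ((hcoord I).comp (pathEquiv D ht hs).measurable).aemeasurable hX.aemeasurable,
      AEMeasurable.map_map_of_aemeasurable hadd.aemeasurable
        (aemeasurable_pi_lambda _ fun i => (hR _ (hpmem i)).1)]
    refine Measure.map_congr ?_
    filter_upwards [hX.apply_zero ht] with ω hω
    exact funext fun i => pathEquiv_solution_apply ht hs hy hω i.1
  have hr : (μ'.map Y).map (fun ω (i : I) => ω i) =
      (μ'.map (fun ω i => (p' i).1 ω)).map (fun w i => y + w i) := by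
    rw [AEMeasurable.map_map_of_aemeasurable (hcoord I).aemeasurable hY.aemeasurable,
      AEMeasurable.map_map_of_aemeasurable hadd.aemeasurable
        (aemeasurable_pi_lambda _ fun i => (hR' _ (hpmem' i)).1)]
    refine Measure.map_congr ?_
    filter_upwards [hY.eq_add] with ω hω
    exact funext fun i => hω i.1
  rw [hl, hr, hlaw]

end Law

/-! ### Conditioning on the terminal value -/

theorem measurable_pathAt {L : ℝ} (r : ℝ) : Measurable fun ω : PathSpace L => pathAt ω r := by
  by_cases hr : r ∈ Icc 0 L
  · simpa only [pathAt_of_mem _ hr] using measurable_coord _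
  · simp only [pathAt, hr, dite_false]
    exact measurable_const

/-- Conditioning on the terminal value commutes with a change of path space `Φ` that acts on the
terminal values through `e`. Regular conditional laws are only determined up to null sets of the
law of the terminal value, whence the absolute continuity of the terminal law. -/
theorem map_conditionedLaw {L L' : ℝ} {R : Measure (PathSpace L)} [IsFiniteMeasure R]
    {R' : Measure (PathSpace L')} [IsFiniteMeasure R'] {π π' : Measure ℝ}
    {Φ : PathSpace L → PathSpace L'} (hΦ : Measurable Φ) (e : ℝ ≃ᵐ ℝ)
    (he : ∀ ω, pathAt (Φ ω) L' = e (pathAt ω L)) (hR : R.map Φ = R') (hπ : π.map e = π')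
    (hac : π' ≪ R'.map fun ω => pathAt ω L') :
    (conditionedLaw R π).map Φ = conditionedLaw R' π' := by
  set κ := condDistrib (fun ω : PathSpace L => ω) (fun ω => pathAt ω L) R with hκ
  set κ' := (κ.map Φ).comap e.symm e.symm.measurable with hκ'
  have hterm : R'.map (fun ω => pathAt ω L') = (R.map fun ω => pathAt ω L).map e := by
    rw [← hR, Measure.map_map (measurable_pathAt _) hΦ,
      Measure.map_map e.measurable (measurable_pathAt _)]
    exact congrArg (Measure.map · R) (funext he)
  -- The kernel `κ'` disintegrates `R'` along the terminal value.
  have hdis : R'.map (fun ω => (pathAt ω L', ω)) = R'.map (fun ω => pathAt ω L') ⊗ₘ κ' := by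
    have h1 : R'.map (fun ω => (pathAt ω L', ω)) =
        ((R.map fun ω => pathAt ω L) ⊗ₘ κ).map (Prod.map e Φ) := by
      rw [hκ, compProd_map_condDistrib aemeasurable_id', ← hR,
        Measure.map_map ((measurable_pathAt _).prodMk measurable_id') hΦ,
        Measure.map_map (e.measurable.prodMap hΦ) ((measurable_pathAt _).prodMk measurable_id')]
      exact congrArg (Measure.map · R) (funext fun ω => Prod.ext (he ω) rfl)
    rw [h1, hterm]
    refine Measure.ext_of_lintegral _ fun f hf => ?_
    rw [lintegral_map hf (e.measurable.prodMap hΦ),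
      Measure.lintegral_compProd (f := fun q => f (Prod.map e Φ q))
        (hf.comp (e.measurable.prodMap hΦ)),
      Measure.lintegral_compProd hf, lintegral_map_equiv]
    refine lintegral_congr fun z => ?_
    rw [hκ', Kernel.comap_apply, MeasurableEquiv.symm_apply_apply, Kernel.map_apply _ hΦ,
      lintegral_map (by fun_prop) hΦ]
    rfl
  have hae := condDistrib_ae_eq_of_measure_eq_compProd (μ := R') (fun ω => pathAt ω L')
    aemeasurable_id' hdis
  rw [conditionedLaw, conditionedLaw, Measure.bind_congr_right (hac.ae_eq hae), ← hκ,
    Measure.map_comp _ _ hΦ, ← hπ]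
  ext A hA
  rw [Measure.bind_apply hA κ'.aemeasurable, Measure.bind_apply hA (κ.map Φ).aemeasurable,
    lintegral_map_equiv]
  refine lintegral_congr fun z => ?_
  rw [hκ', Kernel.comap_apply, MeasurableEquiv.symm_apply_apply]

theorem lawProportionalTo_absolutelyContinuous (w : ℝ → ℝ) : lawProportionalTo w ≪ volume :=
  (withDensity_absolutelyContinuous _ _).smul_left _

/-- The affine change of variable `z ↦ (z - a) / b`, for `b > 0`. -/
noncomputable def standardize (a : ℝ) {b : ℝ} (hb : 0 < b) : ℝ ≃ᵐ ℝ where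
  toFun z := (z - a) / b
  invFun z := a + b * z
  left_inv z := by
    have := hb.ne'
    field_simp
    ring
  right_inv z := by
    have := hb.ne'
    field_simp
    ring
  measurable_toFun := by change Measurable fun z => (z - a) / b; fun_prop
  measurable_invFun := by change Measurable fun z => a + b * z; fun_prop

theorem standardize_apply (a : ℝ) {b : ℝ} (hb : 0 < b) (z : ℝ) :
    standardize a hb z = (z - a) / b := rfl

theorem map_standardize_volume (a : ℝ) {b : ℝ} (hb : 0 < b) :
    (volume : Measure ℝ).map (standardize a hb) = ENNReal.ofReal b • volume := by
  have h1 : (volume : Measure ℝ).map (fun z => z - a) = volume :=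
    map_sub_right_eq_self _ a
  have h2 := Real.map_volume_mul_right (inv_ne_zero hb.ne')
  rw [inv_inv, abs_of_pos hb] at h2
  rw [← h2]
  nth_rewrite 2 [← h1]
  rw [Measure.map_map (by fun_prop) (by fun_prop)]
  rfl

/-- Laws with proportional densities transform well under affine maps, also when the weight is not
integrable and both laws are zero by convention. -/
theorem map_standardize_lawProportionalTo {w w' : ℝ → ℝ} (hw : Measurable w) (a : ℝ) {b c : ℝ}
    (hb : 0 < b) (hc : 0 < c) (hw' : ∀ z, w' z = c * w ((z - a) / b)) :
    (lawProportionalTo w').map (standardize a hb) = lawProportionalTo w := by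
  have hden : (volume.withDensity fun z => ENNReal.ofReal (w' z)).map (standardize a hb) =
      ENNReal.ofReal (c * b) • volume.withDensity fun z => ENNReal.ofReal (w z) := by
    ext A hA
    rw [MeasurableEquiv.map_apply, withDensity_apply _ ((standardize a hb).measurable hA),
      Measure.smul_apply, withDensity_apply _ hA]
    have e (z : ℝ) : ENNReal.ofReal (w' z) =
        ENNReal.ofReal c * ENNReal.ofReal (w (standardize a hb z)) := by
      rw [hw', ENNReal.ofReal_mul hc.le, standardize_apply]
    simp_rw [e]
    rw [lintegral_const_mul' _ _ ENNReal.ofReal_ne_top,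
      ← setLIntegral_map (f := fun z => ENNReal.ofReal (w z)) hA (by fun_prop)
        (standardize a hb).measurable, map_standardize_volume,
      Measure.restrict_smul, lintegral_smul_measure, smul_eq_mul, smul_eq_mul,
      ENNReal.ofReal_mul hc.le, mul_assoc]
  have hK0 : ENNReal.ofReal (c * b) ≠ 0 := by
    rw [Ne, ENNReal.ofReal_eq_zero, not_le]
    positivity
  have htot : ∫⁻ z, ENNReal.ofReal (w' z) =
      ENNReal.ofReal (c * b) * ∫⁻ z, ENNReal.ofReal (w z) := by
    have := congrArg (fun P => P univ) hden
    simpa [MeasurableEquiv.map_apply] using this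
  rw [lawProportionalTo, lawProportionalTo, Measure.map_smul, hden, htot, smul_smul,
    ENNReal.mul_inv (Or.inl hK0) (Or.inl ENNReal.ofReal_ne_top), mul_right_comm,
    ENNReal.inv_mul_cancel hK0 ENNReal.ofReal_ne_top, one_mul]

theorem normalDensity_affine (a y : ℝ) {b v : ℝ} (hb : 0 < b) (hv : 0 < v) (z : ℝ) :
    normalDensity (a + b * y) (b ^ 2 * v) z = normalDensity y v ((z - a) / b) / b := by
  simp only [normalDensity, gaussianPDFReal]
  rw [Real.coe_toNNReal _ hv.le, Real.coe_toNNReal _ (by positivity),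
    show 2 * Real.pi * (b ^ 2 * v) = b ^ 2 * (2 * Real.pi * v) by ring,
    Real.sqrt_mul (sq_nonneg b), Real.sqrt_sq hb.le, mul_inv]
  have : -(z - (a + b * y)) ^ 2 / (2 * (b ^ 2 * v)) = -((z - a) / b - y) ^ 2 / (2 * v) := by
    field_simp
    ring
  rw [this]
  ring

section Pinning

variable {D : Params} {t x s y : ℝ}

theorem Params.a₀_one : D.a₀ 1 = D.m D.T := by
  rw [Params.a₀, one_mul, Params.hT, D.hInv_h D.T_mem]

theorem Params.a₁_one : D.a₁ 1 = D.φ 0 D.T * √D.hT := by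
  rw [Params.a₁, one_mul]
  nth_rewrite 1 [Params.hT]
  rw [D.hInv_h D.T_mem]

theorem lt_one_iff_lt_T (ht : t ∈ Icc 0 D.T) (hs : s = D.h t / D.hT) : s < 1 ↔ t < D.T := by
  rw [hs, div_lt_one D.hT_pos, Params.hT, D.strictMonoOn_h.lt_iff_lt ht D.T_mem]

theorem measurable_normalDensity (θ v : ℝ) : Measurable (normalDensity θ v) :=
  measurable_gaussianPDFReal _ _

/-- The affine map that standardizes the terminal value carries the pinning law of the randomized
Gauss–Markov bridge to that of the randomized Brownian bridge. -/
theorem map_standardize_gmPinningLaw {ν : ℝ → ℝ} (hν : Measurable ν) (ht : t ∈ Icc 0 D.T)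
    (hs : s = D.h t / D.hT) (hy : y = (x - D.m t) / (D.φ 0 t * √D.hT)) :
    (gmPinningLaw D ν t x).map (standardize (D.m D.T) (D.scale_pos D.T)) =
      bbPinningLaw ν D.y₀ s y := by
  have hT := D.hT_pos
  have hsq : √D.hT ^ 2 = D.hT := Real.sq_sqrt hT.le
  have hsqrt := (Real.sqrt_pos.2 hT).ne'
  have hφt := (D.φ_pos 0 t).ne'
  rw [gmPinningLaw, bbPinningLaw]
  by_cases htT : t < D.T
  · have hs1 := (lt_one_iff_lt_T ht hs).2 htT
    rw [if_pos htT, if_pos hs1]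
    have hb := D.scale_pos D.T
    refine map_standardize_lawProportionalTo
      (((measurable_normalDensity _ _).div (measurable_normalDensity _ _)).mul hν) _ hb
      (inv_pos.2 hb) fun z => ?_
    have hm : D.condMean t x D.T = D.m D.T + D.φ 0 D.T * √D.hT * y := by
      rw [D.condMean_eq x ht D.T_mem, hy]
      field_simp
    have hv : D.condVar t D.T = (D.φ 0 D.T * √D.hT) ^ 2 * (1 - s) := by
      rw [D.condVar_eq ht D.T_mem, mul_pow, hsq, hs]
      simp only [Params.hT] at hT ⊢
      field_simp
    have hm₀ : D.condMean 0 D.x₀ D.T = D.m D.T + D.φ 0 D.T * √D.hT * D.y₀ := by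
      rw [D.condMean_eq _ D.zero_mem D.T_mem, Params.y₀, D.φ_self, D.m_eq 0]
      simp only [intervalIntegral.integral_same, mul_zero, sub_zero, div_one]
      field_simp
    have hv₀ : D.condVar 0 D.T = (D.φ 0 D.T * √D.hT) ^ 2 * 1 := by
      rw [D.condVar_eq D.zero_mem D.T_mem, D.h_zero, mul_pow, hsq, Params.hT]
      ring
    rw [hm, hv, hm₀, hv₀, normalDensity_affine _ _ hb (sub_pos.2 hs1),
      normalDensity_affine _ _ hb one_pos, div_div_div_cancel_right₀ hb.ne',
      Params.terminalDensity, Params.a₀_one, Params.a₁_one]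
    simp only [Pi.mul_apply, Pi.div_apply]
    ring
  · have htT' : t = D.T := le_antisymm ht.2 (not_lt.1 htT)
    rw [if_neg htT, if_neg fun h => htT ((lt_one_iff_lt_T ht hs).1 h),
      Measure.map_dirac, standardize_apply, hy, htT']

theorem pathAt_pathEquiv_terminal (ht : t ∈ Icc 0 D.T) (hs : s = D.h t / D.hT)
    (ω : PathSpace (D.T - t)) : pathAt (pathEquiv D ht hs ω) (1 - s) =
      standardize (D.m D.T) (D.scale_pos D.T) (pathAt ω (D.T - t)) := by
  have hL : D.T - t ∈ Icc 0 (D.T - t) := right_mem_Icc.2 (sub_nonneg.2 ht.2)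
  have hs1 : s ≤ 1 := by
    have := D.strictMonoOn_h.monotoneOn ht D.T_mem ht.2
    rw [hs]
    exact (div_le_one D.hT_pos).2 this
  have hL' : 1 - s ∈ Icc 0 (1 - s) := right_mem_Icc.2 (sub_nonneg.2 hs1)
  rw [pathAt_of_mem _ hL, pathAt_of_mem _ hL', pathEquiv_apply, standardize_apply,
    ← clock_terminal ht hs hL hL', OrderIso.symm_apply_apply]
  simp only [add_sub_cancel]

/-- The pinning law is dominated by the law of the Brownian motion at time `1`: for `s < 1` the
former has a density and the latter a positive one, and for `s = 1` they are the same point mass. -/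
theorem bbPinningLaw_absolutelyContinuous (ν : ℝ → ℝ) (y₀ : ℝ) {Ω : Type*} [MeasurableSpace Ω]
    {μ : Measure Ω} [IsProbabilityMeasure μ] {B : ℝ≥0 → Ω → ℝ} (hB : IsPreBrownianReal B μ)
    {Y : Ω → PathSpace (1 - s)} (hY : IsBrownianFrom μ B s y Y) (hs0 : 0 ≤ s) (hs1 : s ≤ 1) :
    bbPinningLaw ν y₀ s y ≪ (μ.map Y).map fun ω => pathAt ω (1 - s) := by
  have hL : 1 - s ∈ Icc 0 (1 - s) := right_mem_Icc.2 (sub_nonneg.2 hs1)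
  have hterm : (μ.map Y).map (fun ω => pathAt ω (1 - s)) =
      μ.map fun ω => y + (B (1 : ℝ).toNNReal ω - B s.toNNReal ω) := by
    rw [AEMeasurable.map_map_of_aemeasurable (measurable_pathAt _).aemeasurable hY.aemeasurable]
    refine Measure.map_congr ?_
    filter_upwards [hY.eq_add] with ω hω
    rw [Function.comp_apply, pathAt_of_mem _ hL, hω]
    simp
  rw [hterm, bbPinningLaw]
  by_cases h1 : s < 1
  · rw [if_pos h1]
    have hlaw : μ.map (fun ω => y + (B (1 : ℝ).toNNReal ω - B s.toNNReal ω)) =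
        gaussianReal y (nndist (1 : ℝ).toNNReal.1 s.toNNReal.1) := by
      have h := hB.hasLaw_sub (1 : ℝ).toNNReal s.toNNReal
      have := gaussianReal_const_add h y
      simpa using this.map_eq
    rw [hlaw]
    refine (lawProportionalTo_absolutelyContinuous _).trans
      (gaussianReal_absolutelyContinuous' _ ?_)
    rw [Ne, nndist_eq_zero]
    intro h
    have h' : (1 : ℝ) = s := by simpa [hs0] using h
    exact h1.ne h'.symm
  · have : s = 1 := le_antisymm hs1 (not_lt.1 h1)
    rw [if_neg h1, this]
    simp [Measure.AbsolutelyContinuous.rfl]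

end Pinning

/-! ### Stopping times and gains -/

theorem pathFiltration_eq {L : ℝ} (u : Icc (0 : ℝ) L) :
    (pathFiltration L u : MeasurableSpace (PathSpace L)) =
      ⨆ j ≤ u, MeasurableSpace.comap (fun ω : PathSpace L => ω j) Real.measurableSpace := rfl

/-- A map between path spaces that acts coordinatewise along a monotone change of time pulls events
known at a time back to events known at the corresponding time. -/
theorem measurableSet_preimage_pathFiltration {L L' : ℝ} {Φ : PathSpace L → PathSpace L'}
    {d : Icc (0 : ℝ) L' → Icc (0 : ℝ) L} (hd : Monotone d) {f : Icc (0 : ℝ) L' → ℝ → ℝ}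
    (hf : ∀ r, Measurable (f r)) (hΦ : ∀ ω r, Φ ω r = f r (ω (d r))) (r : Icc (0 : ℝ) L')
    {A : Set (PathSpace L')} (hA : MeasurableSet[pathFiltration L' r] A) :
    MeasurableSet[pathFiltration L (d r)] (Φ ⁻¹' A) := by
  have hle : (pathFiltration L' r : MeasurableSpace (PathSpace L')).comap Φ ≤
      pathFiltration L (d r) := by
    rw [pathFiltration_eq, pathFiltration_eq]
    simp_rw [MeasurableSpace.comap_iSup, MeasurableSpace.comap_comp]
    refine iSup₂_le fun j hj => ?_
    have : (fun ω : PathSpace L' => ω j) ∘ Φ = f j ∘ fun ω : PathSpace L => ω (d j) :=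
      funext fun ω => hΦ ω j
    rw [this, ← MeasurableSpace.comap_comp]
    exact (MeasurableSpace.comap_mono (hf j).comap_le).trans
      (le_iSup₂ (f := fun k (_ : k ≤ d r) =>
        MeasurableSpace.comap (fun ω : PathSpace L => ω k) Real.measurableSpace) (d j) (hd hj))
  exact hle _ ⟨A, hA, rfl⟩

section Stopping

variable {D : Params} {t x s y : ℝ}

theorem isPathStoppingTime_iff {L : ℝ} {τ : PathSpace L → Icc (0 : ℝ) L} :
    IsPathStoppingTime τ ↔ ∀ u, MeasurableSet[pathFiltration L u] {ω | τ ω ≤ u} := by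
  simp only [IsPathStoppingTime, IsStoppingTime, WithTop.coe_le_coe]

theorem isPathStoppingTime_iff_of_timesCorrespond (ht : t ∈ Icc 0 D.T) (hs : s = D.h t / D.hT)
    {τ : PathSpace (D.T - t) → Icc (0 : ℝ) (D.T - t)} {σ : PathSpace (1 - s) → Icc (0 : ℝ) (1 - s)}
    (h : TimesCorrespond D t s τ σ) : IsPathStoppingTime τ ↔ IsPathStoppingTime σ := by
  rw [timesCorrespond_iff ht hs] at h
  rw [isPathStoppingTime_iff, isPathStoppingTime_iff]
  constructor
  · intro hτ r
    have := measurableSet_preimage_pathFiltration (Φ := (pathEquiv D ht hs).symm)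
      (d := clock D ht hs) (clock D ht hs).monotone
      (f := fun u z => D.m (t + u) + D.φ 0 (t + u) * √D.hT * z) (fun _ => by fun_prop)
      (pathEquiv_symm_apply ht hs) _ (hτ ((clock D ht hs).symm r))
    rw [OrderIso.apply_symm_apply] at this
    convert this using 1
    ext η
    simp only [mem_ofPred_eq, mem_preimage, h, OrderIso.le_symm_apply]
  · intro hσ u
    have := measurableSet_preimage_pathFiltration (Φ := pathEquiv D ht hs)
      (d := (clock D ht hs).symm) (clock D ht hs).symm.monotone
      (f := fun r z => (z - D.m (t + (clock D ht hs).symm r)) /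
        (D.φ 0 (t + (clock D ht hs).symm r) * √D.hT)) (fun _ => by fun_prop)
      (pathEquiv_apply ht hs) _ (hσ (clock D ht hs u))
    rw [OrderIso.symm_apply_apply] at this
    convert this using 1
    ext ω
    simp only [mem_ofPred_eq, mem_preimage, h, MeasurableEquiv.symm_apply_apply,
      OrderIso.le_iff_le]

/-- Corresponding random times give the same gain path by path, hence in expectation. -/
theorem expectedGain_eq_of_timesCorrespond (ht : t ∈ Icc 0 D.T) (hs : s = D.h t / D.hT)
    {τ : PathSpace (D.T - t) → Icc (0 : ℝ) (D.T - t)} {σ : PathSpace (1 - s) → Icc (0 : ℝ) (1 - s)}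
    (h : TimesCorrespond D t s τ σ) (P : Measure (PathSpace (D.T - t))) :
    expectedGain (P.map (pathEquiv D ht hs)) (bridgeGain D s) σ =
      expectedGain P identityGain τ := by
  rw [expectedGain, expectedGain, integral_map_equiv]
  refine integral_congr_ae (ae_of_all _ fun ω => ?_)
  have hω := pathsCorrespond_pathEquiv ht hs ω
  exact (hω (τ ω) (σ (pathEquiv D ht hs ω)) (h _ _ hω)).symm

theorem existsUnique_timesCorrespond_left (ht : t ∈ Icc 0 D.T) (hs : s = D.h t / D.hT)
    (τ : PathSpace (D.T - t) → Icc (0 : ℝ) (D.T - t)) : ∃! σ, TimesCorrespond D t s τ σ := by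
  simp only [timesCorrespond_iff ht hs, ← funext_iff]
  exact existsUnique_eq

theorem existsUnique_timesCorrespond_right (ht : t ∈ Icc 0 D.T) (hs : s = D.h t / D.hT)
    (σ : PathSpace (1 - s) → Icc (0 : ℝ) (1 - s)) : ∃! τ, TimesCorrespond D t s τ σ := by
  refine ⟨fun ω => (clock D ht hs).symm (σ (pathEquiv D ht hs ω)),
    (timesCorrespond_iff ht hs _ _).2 fun η => by simp, fun τ hτ => funext fun ω => ?_⟩
  rw [(timesCorrespond_iff ht hs _ _).1 hτ, MeasurableEquiv.symm_apply_apply,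
    OrderIso.symm_apply_apply]

theorem stoppingValue_map_pathEquiv (ht : t ∈ Icc 0 D.T) (hs : s = D.h t / D.hT)
    (P : Measure (PathSpace (D.T - t))) :
    stoppingValue P identityGain =
      stoppingValue (P.map (pathEquiv D ht hs)) (bridgeGain D s) := by
  refine le_antisymm (iSup₂_le fun τ hτ => ?_) (iSup₂_le fun σ hσ => ?_)
  · obtain ⟨σ, h, -⟩ := existsUnique_timesCorrespond_left ht hs τ
    rw [← expectedGain_eq_of_timesCorrespond ht hs h]
    exact le_iSup₂_of_le σ ((isPathStoppingTime_iff_of_timesCorrespond ht hs h).1 hτ) le_rfl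
  · obtain ⟨τ, h, -⟩ := existsUnique_timesCorrespond_right ht hs σ
    rw [expectedGain_eq_of_timesCorrespond ht hs h]
    exact le_iSup₂_of_le τ ((isPathStoppingTime_iff_of_timesCorrespond ht hs h).2 hσ) le_rfl

/-- The randomized Gauss–Markov bridge is carried to the randomized Brownian bridge. -/
theorem map_pathEquiv_gmBridgeLaw {ν : ℝ → ℝ} (hν : Measurable ν) (ht : t ∈ Icc 0 D.T)
    (hs : s = D.h t / D.hT) (hy : y = (x - D.m t) / (D.φ 0 t * √D.hT))
    {Ω : Type*} [MeasurableSpace Ω] {μ : Measure Ω} [IsProbabilityMeasure μ]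
    {B : ℝ≥0 → Ω → ℝ} (hB : IsPreBrownianReal B μ)
    {X : Ω → PathSpace (D.T - t)} (hX : D.IsSolution μ B t x X)
    {Ω' : Type*} [MeasurableSpace Ω'] {μ' : Measure Ω'} [IsProbabilityMeasure μ']
    {B' : ℝ≥0 → Ω' → ℝ} (hB' : IsPreBrownianReal B' μ')
    {Y : Ω' → PathSpace (1 - s)} (hY : IsBrownianFrom μ' B' s y Y) :
    (gmBridgeLaw D ν t x μ X).map (pathEquiv D ht hs) = bbBridgeLaw ν D.y₀ s y μ' Y := by
  have hmono := D.strictMonoOn_h.monotoneOn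
  have hs0 : 0 ≤ s := by
    rw [hs]
    exact div_nonneg (D.h_zero.symm.trans_le (hmono D.zero_mem ht ht.1)) D.hT_pos.le
  have hs1 : s ≤ 1 := by
    rw [hs]
    exact (div_le_one D.hT_pos).2 (hmono ht D.T_mem ht.2)
  exact map_conditionedLaw (pathEquiv D ht hs).measurable _ (pathAt_pathEquiv_terminal ht hs)
    (map_pathEquiv_solution hB hX hB' hY ht hs hy) (map_standardize_gmPinningLaw hν ht hs hy)
    (bbPinningLaw_absolutelyContinuous ν D.y₀ hB' hY hs0 hs1)

end Stopping

end GaussMarkov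

open GaussMarkov
theorem mainTheorem1 (D : Params) (ν : ℝ → ℝ) (hν : IsDensity ν)
    (hreg : RegularTerminalDensity ν D.y₀)
    (t x s y : ℝ) (ht : t ∈ Set.Icc 0 D.T)
    (hs : s = D.h t / D.hT) (hy : y = (x - D.m t) / (D.φ 0 t * √D.hT))
    {Ω : Type*} [MeasurableSpace Ω] (μ : Measure Ω) [IsProbabilityMeasure μ]
    (B : ℝ≥0 → Ω → ℝ) (hB : IsBrownianReal B μ)
    (X : Ω → PathSpace (D.T - t)) (hX : D.IsSolution μ B t x X)
    {Ω' : Type*} [MeasurableSpace Ω'] (μ' : Measure Ω') [IsProbabilityMeasure μ']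
    (B' : ℝ≥0 → Ω' → ℝ) (hB' : IsBrownianReal B' μ')
    (Y : Ω' → PathSpace (1 - s)) (hY : IsBrownianFrom μ' B' s y Y) :
    stoppingValue (gmBridgeLaw D ν t x μ X) identityGain
        = stoppingValue (bbBridgeLaw ν D.y₀ s y μ' Y) (bridgeGain D s) ∧
      (∀ τ, ∃! σ, TimesCorrespond D t s τ σ) ∧
      (∀ σ, ∃! τ, TimesCorrespond D t s τ σ) ∧
      ∀ τ σ, TimesCorrespond D t s τ σ →
        (IsOptimalStoppingTime (gmBridgeLaw D ν t x μ X) identityGain τ ↔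
          IsOptimalStoppingTime (bbBridgeLaw ν D.y₀ s y μ' Y) (bridgeGain D s) σ) := by
  rw [← map_pathEquiv_gmBridgeLaw hν.measurable ht hs hy hB.toIsPreBrownianReal hX
    hB'.toIsPreBrownianReal hY]
  refine ⟨stoppingValue_map_pathEquiv ht hs _, existsUnique_timesCorrespond_left ht hs,
    existsUnique_timesCorrespond_right ht hs, fun τ σ h => ?_⟩
  rw [IsOptimalStoppingTime, IsOptimalStoppingTime, ← stoppingValue_map_pathEquiv ht hs,
    expectedGain_eq_of_timesCorrespond ht hs h, isPathStoppingTime_iff_of_timesCorrespond ht hs h]
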